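/- Let $k,m,n,\ell,q,Q,s,T$ be non-negative integers with $m\ge 1$, $q\le 2^m$, $T=s(2m-1)$, and put $\alpha=\ell+m(q+1)+T$; assume $\alpha+n\le k$. **The cipher.** A random oracle assigns to each pair $(R,r)$ with $R\in\{0,1\}^{m-1}$, $r\in\{1,\dots,T\}$ an independent answer $(P,\mathcal S)$, where $P=(P_1,\dots,P_n)$ consists of $n$ independent uniform samples (with replacement) from $\{1,\dots,k\}$ and $\mathcal S$ is an independent uniformly random subset of $\{1,\dots,n\}$. For a key $K\in\{0,1\}^k$ let $F_K(R,r)=\bigoplus_{i\in\mathcal S}K[P_i]$. Round $r$ of the Thorp shuffle maps a string $LR\in\{0,1\}^m$, with $L$ of length $1$ and $R$ of length $m-1$, to $RL'$, where $L'=L\oplus F_K(R,r)$. The cipher $X_T$ is the composition of rounds $1,\dots,T$. **The adversary.** A (possibly randomized) adversary first makes at most $Q$ adaptive calls to the random oracle and then chooses a leakage function $\Phi:\{0,1\}^k\to\{0,1\}^\ell$. A uniformly random key $K\in\{0,1\}^k$ and uniformly random distinct messages $M_1,\dots,M_q\in\{0,1\}^m$ are drawn, independently of each other and of the oracle. In world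 1, $C_i=X_T(M_i)$; in world 0, $C_i=\pi(M_i)$ for an independent uniformly random permutation $\pi$ of $\{0,1\}^m$. In either world the adversary is then given the leakage $\Phi(K)$, the pairs $(M_1,C_1),\dots,(M_q,C_q)$ and access to all answers of the random oracle (in particular those that the cipher uses; it is not told on which inputs the cipher called the oracle), and it guesses the world. Its advantage is $\mathbf{Adv}(\mathcal A)=\mathbb P_1(\mathcal A\text{ guesses }1)-\mathbb P_0(\mathcal A\text{ guesses }1)$, and $\mathbf{MaxAdv}_{Q,q}$ is the supremum of $\mathbf{Adv}(\mathcal A)$ over all such adversaries. **Theorem.** $$\mathbf{MaxAdv}_{Q,q}\le \frac{q}{s+1}\left(\frac{4mq}{2^m}\right)^s+\frac{qT}{2}\left[h^{-1}\left(1-\frac{\alpha+n}{k}\right)\right]^{n/2}+\frac{qQ}{2^{m-1}}+\frac{qT}{2^m},$$ where $h(p)=p\log_2\frac1p+(1-p)\log_2\frac1{1-p}$ (with $0\log_2\frac10=0$) and $h^{-1}:[0,1]\to[\tfrac12,1]$ is the inverse of the restriction of $h$ to $[\tfrac12,1]$. -/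

import Mathlib

noncomputable section

namespace BigKeyThorp

/-- Bits are elements of `ZMod 2`, so that XOR is addition. -/
abbrev Bits (j : ℕ) : Type := Fin j → ZMod 2

/-- An input `(R, r)` of the random oracle: `m - 1` bits and a round number
(rounds `1, …, T` are numbered `0, …, T - 1`). -/
abbrev Query (m T : ℕ) : Type := Bits (m - 1) × Fin T

/-- An answer `(P, S)` of the random oracle: `n` probes into the key and a set of probe indices. -/
abbrev Answer (k n : ℕ) : Type := (Fin n → Fin k) × Finset (Fin n)

/-- A full table of the random oracle. A uniformly random table has independent answers, each with
`P` uniform (`n` samples with replacement) and `S` an independent uniform subset. -/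
abbrev Oracle (k m n T : ℕ) : Type := Query m T → Answer k n

/-- The rightmost `m - 1` bits of a message. -/
def right {m : ℕ} (x : Bits m) : Bits (m - 1) := fun i => x ⟨i + 1, by omega⟩

/-- One Thorp shuffle with round function `F`: `L R ↦ R L'` with `L' = L ⊕ F R`,
where `L` is the first bit. -/
def thorpRound {m : ℕ} (F : Bits (m - 1) → ZMod 2) (x : Bits m) : Bits m := fun i =>
  if h : (i : ℕ) + 1 < m then x ⟨i + 1, h⟩
  else x ⟨0, by omega⟩ + F (right x)

/-- The big-key pseudorandom function: the XOR of the subsequence of the subkey selected by `S`. -/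
def bigKeyPRF {k m n T : ℕ} (O : Oracle k m n T) (K : Bits k) (R : Bits (m - 1)) (r : Fin T) :
    ZMod 2 :=
  ∑ i ∈ (O (R, r)).2, K ((O (R, r)).1 i)

/-- The cipher: `T` Thorp shuffles, the `r`-th with round function `bigKeyPRF O K · r`. -/
def cipher {k m n T : ℕ} (O : Oracle k m n T) (K : Bits k) (x : Bits m) : Bits m :=
  Fin.foldl T (fun y r => thorpRound (fun R => bigKeyPRF O K R r) y) x

/-- Deterministic adaptive algorithms that make at most `Q` calls to an oracle `I → A` and
return an element of `β`. -/
inductive OracleAlg (I A β : Type) : ℕ → Type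
  | ret {Q : ℕ} (b : β) : OracleAlg I A β Q
  | ask {Q : ℕ} (x : I) (next : A → OracleAlg I A β Q) : OracleAlg I A β (Q + 1)

/-- The value returned by an algorithm that interacts with the oracle `O`. -/
def OracleAlg.run {I A β : Type} (O : I → A) : {Q : ℕ} → OracleAlg I A β Q → β
  | _, .ret b => b
  | _, .ask x next => (next (O x)).run O

/-- What the adversary sees before guessing: the leakage, the plaintext-ciphertext pairs, and the
answers of the random oracle, in particular all those which the cipher uses. -/
structure View (k m n ℓ q T : ℕ) : Type where
  leakage : Bits ℓ
  pairs : Fin q → Bits m × Bits m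
  oracle : Oracle k m n T

/-- A deterministic adversary makes at most `Q` adaptive oracle calls and then, depending on the
answers, fixes a leakage function and a rule for guessing the world (`true` is world 1). -/
abbrev DetAdversary (k m n ℓ q Q T : ℕ) : Type :=
  OracleAlg (Query m T) (Answer k n) ((Bits k → Bits ℓ) × (View k m n ℓ q T → Bool)) Q

/-- An adversary is a randomized choice of a deterministic one. -/
abbrev Adversary (k m n ℓ q Q T : ℕ) : Type := PMF (DetAdversary k m n ℓ q Q T)

theorem nonempty_messages {m q : ℕ} (hq : q ≤ 2 ^ m) : Nonempty (Fin q ↪ Bits m) := by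
  apply Function.Embedding.nonempty_of_card_le
  simpa [ZMod.card] using hq

/-- Uniformly random distinct messages `M₁, …, M_q`. -/
def randomMessages {m q : ℕ} (hq : q ≤ 2 ^ m) : PMF (Fin q ↪ Bits m) :=
  haveI := nonempty_messages hq
  PMF.uniformOfFintype (Fin q ↪ Bits m)

/-- The adversary's guess in world 1, where `Cᵢ` is the encryption of `Mᵢ`. -/
def world1 {k m n ℓ q Q T : ℕ} [NeZero k] (hq : q ≤ 2 ^ m) (𝒜 : Adversary k m n ℓ q Q T) :
    PMF Bool :=
  𝒜.bind fun A =>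
  (PMF.uniformOfFintype (Oracle k m n T)).bind fun O =>
  (PMF.uniformOfFintype (Bits k)).bind fun K =>
  (randomMessages hq).bind fun M =>
  PMF.pure ((A.run O).2
    { leakage := (A.run O).1 K
      pairs := fun i => (M i, cipher O K (M i))
      oracle := O })

/-- The adversary's guess in world 0, where `Cᵢ = π Mᵢ` for a uniformly random permutation `π`. -/
def world0 {k m n ℓ q Q T : ℕ} [NeZero k] (hq : q ≤ 2 ^ m) (𝒜 : Adversary k m n ℓ q Q T) :
    PMF Bool :=
  𝒜.bind fun A =>
  (PMF.uniformOfFintype (Oracle k m n T)).bind fun O =>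
  (PMF.uniformOfFintype (Bits k)).bind fun K =>
  (randomMessages hq).bind fun M =>
  (PMF.uniformOfFintype (Equiv.Perm (Bits m))).bind fun π =>
  PMF.pure ((A.run O).2
    { leakage := (A.run O).1 K
      pairs := fun i => (M i, π (M i))
      oracle := O })

/-- The advantage `P₁(𝒜(1) = 1) - P₀(𝒜(0) = 1)`. -/
def adv {k m n ℓ q Q T : ℕ} [NeZero k] (hq : q ≤ 2 ^ m) (𝒜 : Adversary k m n ℓ q Q T) : ℝ :=
  (world1 hq 𝒜 true).toReal - (world0 hq 𝒜 true).toReal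

/-- The maximum advantage over all adversaries with `ℓ` bits of leakage, `q` pairs and
at most `Q` oracle calls. -/
def maxAdv (k m n ℓ q Q T : ℕ) [NeZero k] (hq : q ≤ 2 ^ m) : ℝ :=
  ⨆ 𝒜 : Adversary k m n ℓ q Q T, adv hq 𝒜

/-- The supremum in `maxAdv` is over a bounded family, so it is a true supremum. -/
theorem adv_le_maxAdv {k m n ℓ q Q T : ℕ} [NeZero k] (hq : q ≤ 2 ^ m)
    (𝒜 : Adversary k m n ℓ q Q T) : adv hq 𝒜 ≤ maxAdv k m n ℓ q Q T hq := by
  refine le_ciSup (f := fun 𝒜 : Adversary k m n ℓ q Q T => adv hq 𝒜) ⟨1, ?_⟩ 𝒜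
  rintro _ ⟨ℬ, rfl⟩
  have h1 : (world1 hq ℬ true).toReal ≤ 1 := by
    simpa using ENNReal.toReal_mono ENNReal.one_ne_top (PMF.coe_le_one (world1 hq ℬ) true)
  have h0 : 0 ≤ (world0 hq ℬ true).toReal := ENNReal.toReal_nonneg
  simp only [adv]
  linarith

/-- The entropy, base 2, of a Bernoulli(`p`) random variable. -/
def h (p : ℝ) : ℝ := p * Real.logb 2 (1 / p) + (1 - p) * Real.logb 2 (1 / (1 - p))

/-- The inverse of the restriction of `h` to `[1/2, 1]`; meaningful on `[0, 1]`. -/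
def hInv : ℝ → ℝ := Function.invFunOn h (Set.Icc (1 / 2) 1)

end BigKeyThorp

end

noncomputable section

namespace BigKeyThorp

open Finset

open scoped BigOperators

/-! ### The binary entropy function and its inverse -/

/-! The advantage is split by an intermediate world in which the Thorp rounds use independent
uniform bits instead of values of the pseudorandom function.

Random bits versus a random permutation (`iterMean_thorpStep_sub_expect_le`): start the shuffle from
a uniform permutation fixing the first `l` messages and let `l` grow from 0 to `q`. Fixing one more
card `x` is handled by a coupling of two shuffles that differ in the start of `x`: the `l` fixed
cards move identically in both, and `x` receives the same new bit in both unless it is adjacent to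
one of them. Each round shifts in one new bit, so `m` rounds without such a meeting bring `x` to the
same place. After `m - 1` rounds of burn-in, a meeting has probability at most `4l/2^m` per round,
so a block of `2m - 1` rounds fails with probability at most `4ml/2^m`, and `s` blocks raise this to
the power `s`. Summing `l^s` over `l < q` gives the factor `q/(s+1)`.

Pseudorandom versus random bits (`expect_cipher_sub_expect_thorpCipher_le`): values are replaced one
at a time along the trajectories of the messages, in `qT` steps. If the adversary has not queried
the point before choosing the leakage, the answer there is fresh, while the key enters the view only
through `ℓ + mq` bits. These bits split the keys into at most `2^(α-m)` classes. On a class with at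
least `2^(k-α)` keys, the second moment of the bias of a random subset parity is an average of
`zeroFrac (K + K') ^ n`. An entropy bound controls it, since a large set cannot consist of strings
with too many zeros (`sum_zeroFrac_pow_le`), and Cauchy–Schwarz yields the exponent `n/2`. The
smaller classes hold at most a fraction `2^(-m)` of the keys. Queried points are rarely visited: the
queries precede the messages, and every position on a random message's trajectory is uniform. This
gives `qQ/2^(m-1)`. -/

theorem h_eq_binEntropy_div (p : ℝ) : h p = Real.binEntropy p / Real.log 2 := by
  simp only [h, Real.binEntropy, Real.logb, one_div]
  ring

/-- By the intermediate value theorem `h` takes every value of `[0, 1]` on `[1/2, 1]`, so `invFunOn`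
does not fall back to its default value. -/
theorem hInv_spec {y : ℝ} (hy : y ∈ Set.Icc (0 : ℝ) 1) :
    hInv y ∈ Set.Icc (1 / 2 : ℝ) 1 ∧ h (hInv y) = y := by
  have hlog : 0 < Real.log 2 := Real.log_pos one_lt_two
  have hcont : ContinuousOn h (Set.Icc (1 / 2) 1) := by
    have : h = fun p => Real.binEntropy p / Real.log 2 := funext h_eq_binEntropy_div
    rw [this]
    fun_prop
  have hmem : y ∈ h '' Set.Icc (1 / 2) 1 := by
    refine intermediate_value_Icc' (by norm_num) hcont ?_
    rw [h_eq_binEntropy_div, h_eq_binEntropy_div, Real.binEntropy_one, one_div,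
      Real.binEntropy_two_inv, div_self hlog.ne', zero_div]
    exact hy
  exact ⟨Function.invFunOn_mem hmem, Function.invFunOn_eq hmem⟩

/-- Strict decrease of the entropy on `[1/2, 1]` turns a lower bound on entropy into an upper bound
on `θ`. Below `1/2` there is nothing to prove. -/
theorem le_hInv {θ y : ℝ} (hy : y ∈ Set.Icc (0 : ℝ) 1) (hθ : θ ≤ 1)
    (hle : 1 / 2 ≤ θ → y ≤ h θ) : θ ≤ hInv y := by
  obtain ⟨hmem, heq⟩ := hInv_spec hy
  by_contra! hlt
  have hθ' : 1 / 2 ≤ θ := hmem.1.trans hlt.le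
  have h1 := hle hθ'
  have h2 : Real.binEntropy θ < Real.binEntropy (hInv y) :=
    Real.binEntropy_strictAntiOn (by simpa using hmem) ⟨by simpa using hθ', hθ⟩ hlt
  have h3 : h θ < h (hInv y) := by
    rw [h_eq_binEntropy_div, h_eq_binEntropy_div]
    exact div_lt_div_of_pos_right h2 (Real.log_pos one_lt_two)
  linarith

/-! ### Moments of the fraction of zeros in a large set of keys -/

/-- The fraction of zero bits. -/
def zeroFrac {k : ℕ} (Z : Bits k) : ℝ := (#{i | Z i = 0} : ℝ) / k

theorem zeroFrac_nonneg {k : ℕ} (Z : Bits k) : 0 ≤ zeroFrac Z := by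
  unfold zeroFrac; positivity

theorem card_zeros_eq {k : ℕ} [NeZero k] (Z : Bits k) : (#{i | Z i = 0} : ℝ) = k * zeroFrac Z := by
  have : (k : ℝ) ≠ 0 := by exact_mod_cast NeZero.ne k
  unfold zeroFrac; field_simp

theorem card_nonzeros_eq {k : ℕ} [NeZero k] (Z : Bits k) :
    (#{i | ¬ Z i = 0} : ℝ) = k * (1 - zeroFrac Z) := by
  have h1 := card_filter_add_card_filter_not (s := (univ : Finset (Fin k))) (fun i => Z i = 0)
  have h2 : (#{i | Z i = 0} : ℝ) + (#{i | ¬ Z i = 0} : ℝ) = k := by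
    rw [← Nat.cast_add, h1]; simp
  have := card_zeros_eq Z
  linarith

theorem zeroFrac_le_one {k : ℕ} [NeZero k] (Z : Bits k) : zeroFrac Z ≤ 1 := by
  have h1 := card_nonzeros_eq Z
  have hk : (0 : ℝ) < k := by exact_mod_cast Nat.pos_of_ne_zero (NeZero.ne k)
  have h2 : (0 : ℝ) ≤ (#{i | ¬ Z i = 0} : ℝ) := by positivity
  rw [h1] at h2
  nlinarith

theorem eq_zero_of_zeroFrac_eq_one {k : ℕ} [NeZero k] {Z : Bits k} (hZ : zeroFrac Z = 1) :
    Z = 0 := by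
  have h1 := card_nonzeros_eq Z
  rw [hZ, sub_self, mul_zero] at h1
  have h2 : #{i | ¬ Z i = 0} = 0 := by exact_mod_cast h1
  rw [card_eq_zero, filter_eq_empty_iff] at h2
  funext i
  simpa using h2 (mem_univ i)

theorem sum_zmod_two {M : Type*} [AddCommMonoid M] (f : ZMod 2 → M) : ∑ b, f b = f 0 + f 1 :=
  Fin.sum_univ_two f

/-- Product Bernoulli weights sum to one. -/
theorem sum_bernoulli_weight (k : ℕ) (θ : ℝ) :
    ∑ Z : Bits k, θ ^ #{i | Z i = 0} * (1 - θ) ^ #{i | ¬ Z i = 0} = 1 := by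
  have h1 : ∀ Z : Bits k, θ ^ #{i | Z i = 0} * (1 - θ) ^ #{i | ¬ Z i = 0}
      = ∏ i, if Z i = 0 then θ else 1 - θ := by
    intro Z
    rw [prod_ite, prod_const, prod_const]
  simp_rw [h1]
  rw [← Fintype.prod_sum (fun (_ : Fin k) (b : ZMod 2) => if b = 0 then θ else 1 - θ)]
  simp [sum_zmod_two]

/-- A set of weights bounded by one whose mean fraction of zeros is `θ` has total weight at most
`exp (k * binEntropy θ)`. -/
theorem sum_weight_le_exp_binEntropy {k : ℕ} [NeZero k] (w : Bits k → ℝ) (hw0 : ∀ Z, 0 ≤ w Z)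
    (hw1 : ∀ Z, w Z ≤ 1) {θ : ℝ} (hθ0 : 0 < θ) (hθ1 : θ ≤ 1)
    (hθ : ∑ Z, w Z * zeroFrac Z = θ * ∑ Z, w Z) :
    ∑ Z, w Z ≤ Real.exp (k * Real.binEntropy θ) := by
  rcases hθ1.lt_or_eq with hlt | rfl
  · have hpos : 0 < 1 - θ := by linarith
    -- The Bernoulli(`θ`) weight of `Z` is `exp (c + (zeroFrac Z - θ) * d)`. Bounding it below by
    -- its tangent line at `zeroFrac Z = θ` makes the linear term cancel in the `w`-average.
    set c : ℝ := k * (θ * Real.log θ + (1 - θ) * Real.log (1 - θ)) with hc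
    set d : ℝ := k * (Real.log θ - Real.log (1 - θ)) with hd
    have hμ : ∀ Z : Bits k, Real.exp c * (1 + (zeroFrac Z - θ) * d)
        ≤ θ ^ #{i | Z i = 0} * (1 - θ) ^ #{i | ¬ Z i = 0} := by
      intro Z
      have : θ ^ #{i | Z i = 0} * (1 - θ) ^ #{i | ¬ Z i = 0}
          = Real.exp c * Real.exp ((zeroFrac Z - θ) * d) := by
        rw [← Real.exp_add]
        nth_rewrite 1 [← Real.exp_log hθ0]
        nth_rewrite 1 [← Real.exp_log hpos]
        rw [← Real.exp_nat_mul, ← Real.exp_nat_mul, ← Real.exp_add, card_zeros_eq,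
          card_nonzeros_eq, hc, hd]
        congr 1
        ring
      rw [this]
      have := Real.add_one_le_exp ((zeroFrac Z - θ) * d)
      gcongr
      linarith
    have h1 : Real.exp c * ∑ Z, w Z ≤ 1 := by
      refine le_of_le_of_eq ?_ (sum_bernoulli_weight k θ)
      calc Real.exp c * ∑ Z, w Z
          = ∑ Z, w Z * (Real.exp c * (1 + (zeroFrac Z - θ) * d)) := by
            have : ∀ Z, w Z * (Real.exp c * (1 + (zeroFrac Z - θ) * d))
                = Real.exp c * (1 - θ * d) * w Z + Real.exp c * d * (w Z * zeroFrac Z) := by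
              intro Z; ring
            simp_rw [this]
            rw [sum_add_distrib, ← mul_sum, ← mul_sum, hθ]
            ring
        _ ≤ ∑ Z : Bits k, θ ^ #{i | Z i = 0} * (1 - θ) ^ #{i | ¬ Z i = 0} := by
            refine sum_le_sum fun Z _ => ?_
            refine (mul_le_mul_of_nonneg_left (hμ Z) (hw0 Z)).trans ?_
            exact mul_le_of_le_one_left (by positivity) (hw1 Z)
    have h2 : k * Real.binEntropy θ = -c := by
      rw [hc, Real.binEntropy, Real.log_inv, Real.log_inv]; ring
    rw [h2, Real.exp_neg, ← one_div, le_div_iff₀ (Real.exp_pos c), mul_comm]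
    exact h1
  -- For `θ = 1` all the weight sits on the zero string.
  · have h1 : ∑ Z, w Z * (1 - zeroFrac Z) = 0 := by
      simp_rw [mul_sub, mul_one]
      rw [sum_sub_distrib, hθ]; ring
    have h2 := (sum_eq_zero_iff_of_nonneg fun Z _ =>
      mul_nonneg (hw0 Z) (sub_nonneg.2 (zeroFrac_le_one Z))).1 h1
    have h3 : ∑ Z, w Z = w 0 := by
      refine sum_eq_single_of_mem 0 (mem_univ _) fun Z _ hZ => ?_
      rcases mul_eq_zero.1 (h2 Z (mem_univ Z)) with h | h
      · exact h
      · exact absurd (eq_zero_of_zeroFrac_eq_one (by linarith)) hZ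
    rw [h3]
    simpa using hw1 0

theorem entropy_rate_mem {k α n : ℕ} (hk : α + n ≤ k) :
    1 - ((α : ℝ) + n) / k ∈ Set.Icc (0 : ℝ) 1 := by
  have h1 : ((α : ℝ) + n) ≤ k := by exact_mod_cast hk
  exact ⟨sub_nonneg.2 (div_le_one_of_le₀ h1 (by positivity)),
    sub_le_self _ (by positivity)⟩

/-- Successive moments have ratios equal to the mean of `zeroFrac` under the weights `zeroFrac ^ j`.
If the `n`-th moment sum exceeds its trivial target `#𝒦 / 2^n`, all these weights have total mass at
least `2^(k-α-n)`, so the entropy bound forces each ratio to be at most `hInv`. -/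
theorem sum_zeroFrac_pow_le {k α n : ℕ} [NeZero k] (hk : α + n ≤ k) (𝒦 : Finset (Bits k))
    (h𝒦 : (2 : ℝ) ^ (k - α) ≤ #𝒦) :
    ∑ Z ∈ 𝒦, zeroFrac Z ^ n ≤ #𝒦 * hInv (1 - ((α : ℝ) + n) / k) ^ n := by
  set y : ℝ := 1 - ((α : ℝ) + n) / k with hy
  have hymem : y ∈ Set.Icc (0 : ℝ) 1 := entropy_rate_mem hk
  obtain ⟨⟨hH, -⟩, -⟩ := hInv_spec hymem
  have hk0 : (0 : ℝ) < k := by exact_mod_cast Nat.pos_of_ne_zero (NeZero.ne k)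
  by_cases hsmall : ∑ Z ∈ 𝒦, zeroFrac Z ^ n ≤ #𝒦 * (1 / 2 : ℝ) ^ n
  · refine hsmall.trans ?_
    gcongr
  push Not at hsmall
  have hlarge : ∀ j ≤ n, (2 : ℝ) ^ (k - α - n) ≤ ∑ Z ∈ 𝒦, zeroFrac Z ^ j := by
    intro j hj
    calc (2 : ℝ) ^ (k - α - n) = 2 ^ (k - α) * (1 / 2) ^ n := by
          rw [← Nat.sub_add_cancel (show n ≤ k - α by omega), pow_add, mul_assoc, ← mul_pow]
          simp
      _ ≤ #𝒦 * (1 / 2 : ℝ) ^ n := by gcongr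
      _ ≤ ∑ Z ∈ 𝒦, zeroFrac Z ^ n := hsmall.le
      _ ≤ _ := sum_le_sum fun Z _ =>
          pow_le_pow_of_le_one (zeroFrac_nonneg Z) (zeroFrac_le_one Z) hj
  have hstep : ∀ j < n, ∑ Z ∈ 𝒦, zeroFrac Z ^ (j + 1) ≤ (∑ Z ∈ 𝒦, zeroFrac Z ^ j) * hInv y := by
    intro j hj
    set A := ∑ Z ∈ 𝒦, zeroFrac Z ^ j with hA
    set B := ∑ Z ∈ 𝒦, zeroFrac Z ^ (j + 1) with hB
    have hA0 : 0 < A := lt_of_lt_of_le (by positivity) (hlarge j hj.le)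
    have hBA : B ≤ A := sum_le_sum fun Z _ =>
      pow_le_pow_of_le_one (zeroFrac_nonneg Z) (zeroFrac_le_one Z) j.le_succ
    have hθ1 : B / A ≤ 1 := div_le_one_of_le₀ hBA hA0.le
    suffices B / A ≤ hInv y by rwa [div_le_iff₀ hA0, mul_comm] at this
    -- Besides selecting the right branch of `h`, `hhalf` supplies the positivity of the mean
    -- required by the entropy bound.
    refine le_hInv hymem hθ1 fun hhalf => ?_
    have h1 : A ≤ Real.exp (k * Real.binEntropy (B / A)) := by
      have := sum_weight_le_exp_binEntropy (k := k) (fun Z => if Z ∈ 𝒦 then zeroFrac Z ^ j else 0)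
        (fun Z => by split_ifs <;> [exact pow_nonneg (zeroFrac_nonneg Z) _; exact le_rfl])
        (fun Z => by
          split_ifs <;> [exact pow_le_one₀ (zeroFrac_nonneg Z) (zeroFrac_le_one Z);
            exact zero_le_one])
        (show 0 < B / A by linarith) hθ1 (by
          simp_rw [ite_mul, zero_mul, ← pow_succ]
          rw [sum_ite_mem, univ_inter, sum_ite_mem, univ_inter, ← hA, ← hB]
          field_simp)
      rwa [sum_ite_mem, univ_inter] at this
    have h2 : (2 : ℝ) ^ (k - α - n) ≤ Real.exp (k * Real.binEntropy (B / A)) :=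
      (hlarge j hj.le).trans h1
    have h3 : ((k - α - n : ℕ) : ℝ) * Real.log 2 ≤ k * Real.binEntropy (B / A) := by
      rw [← Real.log_pow, ← Real.log_exp (k * _)]
      exact Real.log_le_log (by positivity) h2
    have h4 : ((k - α - n : ℕ) : ℝ) = k * y := by
      rw [Nat.sub_sub, Nat.cast_sub hk, hy]
      push_cast
      field_simp
    rw [h4, mul_assoc, mul_le_mul_iff_right₀ hk0] at h3
    rw [h_eq_binEntropy_div, le_div_iff₀ (Real.log_pos one_lt_two)]
    exact h3
  have hind : ∀ j ≤ n, ∑ Z ∈ 𝒦, zeroFrac Z ^ j ≤ #𝒦 * hInv y ^ j := by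
    intro j
    induction j with
    | zero => intro _; simp
    | succ j ih =>
      intro hj
      calc _ ≤ (∑ Z ∈ 𝒦, zeroFrac Z ^ j) * hInv y := hstep j (by omega)
        _ ≤ (#𝒦 * hInv y ^ j) * hInv y := by
            have := ih (by omega)
            gcongr
        _ = _ := by ring
  exact hind n le_rfl

/-! ### The bias of the subset parities of a large set of keys -/

/-- The nontrivial character of `ZMod 2`. -/
def sign (b : ZMod 2) : ℝ := if b = 0 then 1 else -1

theorem zmod_two_cases : ∀ b : ZMod 2, b = 0 ∨ b = 1 := by decide

theorem sign_add (a b : ZMod 2) : sign (a + b) = sign a * sign b := by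
  have h : (1 : ZMod 2) + 1 = 0 := by decide
  rcases zmod_two_cases a with rfl | rfl <;> rcases zmod_two_cases b with rfl | rfl <;>
    simp [sign, h]

theorem abs_sign (b : ZMod 2) : |sign b| = 1 := by
  unfold sign; split_ifs <;> simp

theorem sign_sum {ι : Type*} (s : Finset ι) (f : ι → ZMod 2) :
    sign (∑ i ∈ s, f i) = ∏ i ∈ s, sign (f i) := by
  classical
  induction s using Finset.induction_on with
  | empty => simp [sign]
  | insert a s ha ih => rw [sum_insert ha, prod_insert ha, sign_add, ih]

/-- The parity of the subkey selected by an oracle answer. -/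
def parity {k n : ℕ} (a : Answer k n) (K : Bits k) : ZMod 2 := ∑ i ∈ a.2, K (a.1 i)

theorem parity_add {k n : ℕ} (a : Answer k n) (K K' : Bits k) :
    parity a (K + K') = parity a K + parity a K' := by
  simp [parity, sum_add_distrib]

/-- The mean of the character of a random subset parity is a moment of the fraction of zeros. -/
theorem expect_sign_parity {k n : ℕ} [NeZero k] (Z : Bits k) :
    𝔼 a : Answer k n, sign (parity a Z) = zeroFrac Z ^ n := by
  have hk0 : (k : ℝ) ≠ 0 := by exact_mod_cast NeZero.ne k
  have h1 : ∀ P : Fin n → Fin k, ∑ S : Finset (Fin n), sign (parity (P, S) Z)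
      = ∏ i, (1 + sign (Z (P i))) := by
    intro P
    rw [prod_one_add, powerset_univ]
    exact sum_congr rfl fun S _ => sign_sum _ _
  have h2 : ∑ j : Fin k, (1 + sign (Z j)) = 2 * (k * zeroFrac Z) := by
    rw [← card_zeros_eq, card_filter]
    push_cast
    rw [mul_sum]
    refine sum_congr rfl fun j _ => ?_
    unfold sign
    split_ifs <;> norm_num
  rw [Fintype.expect_eq_sum_div_card, Fintype.sum_prod_type]
  simp_rw [h1]
  rw [← Fintype.sum_pow (fun j => 1 + sign (Z j)), h2]
  simp only [Fintype.card_prod, Fintype.card_pi, prod_const, Fintype.card_fin, Fintype.card_finset,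
    card_univ]
  push_cast
  rw [mul_pow, mul_pow]
  field_simp

/-- Expanding the square leaves characters of `K + K'`, because parity is linear in the key. -/
theorem expect_sq_sum_sign_parity {k n : ℕ} [NeZero k] (𝒦 : Finset (Bits k)) :
    𝔼 a : Answer k n, (∑ K ∈ 𝒦, sign (parity a K)) ^ 2
      = ∑ K ∈ 𝒦, ∑ K' ∈ 𝒦, zeroFrac (K + K') ^ n := by
  simp_rw [sq, sum_mul_sum, ← sign_add, ← parity_add]
  rw [expect_sum_comm]
  refine sum_congr rfl fun K _ => ?_
  rw [expect_sum_comm]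
  exact sum_congr rfl fun K' _ => expect_sign_parity _

theorem sum_comp_add_left_zeroFrac {k : ℕ} (n : ℕ) (𝒦 : Finset (Bits k)) (K : Bits k) :
    ∑ K' ∈ 𝒦, zeroFrac (K + K') ^ n = ∑ Z ∈ 𝒦.image (K + ·), zeroFrac Z ^ n := by
  rw [sum_image]
  intro a _ b _ hab
  exact add_left_cancel hab

/-- For fixed `K` the strings `K + K'` form a translate of `𝒦`, of the same size, so the moment
bound applies to each row of the second moment. Cauchy–Schwarz then passes to the first moment. -/
theorem expect_abs_sum_sign_parity_le {k α n : ℕ} [NeZero k] (hk : α + n ≤ k)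
    (𝒦 : Finset (Bits k)) (h𝒦 : (2 : ℝ) ^ (k - α) ≤ #𝒦) :
    𝔼 a : Answer k n, |∑ K ∈ 𝒦, sign (parity a K)|
      ≤ #𝒦 * hInv (1 - ((α : ℝ) + n) / k) ^ ((n : ℝ) / 2) := by
  set H := hInv (1 - ((α : ℝ) + n) / k) with hH
  have hH0 : 0 ≤ H := le_trans (by norm_num) (hInv_spec (entropy_rate_mem hk)).1.1
  have h1 : 𝔼 a : Answer k n, (∑ K ∈ 𝒦, sign (parity a K)) ^ 2 ≤ (#𝒦 * H ^ ((n : ℝ) / 2)) ^ 2 := by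
    have hpow : (H ^ ((n : ℝ) / 2)) ^ 2 = H ^ n := by
      rw [← Real.rpow_natCast (H ^ _), ← Real.rpow_mul hH0, ← Real.rpow_natCast H n]
      congr 1
      push_cast
      ring
    rw [expect_sq_sum_sign_parity, mul_pow, hpow, sq, mul_assoc, ← nsmul_eq_mul]
    refine sum_le_card_nsmul _ _ _ fun K _ => ?_
    have hcard : #(𝒦.image (K + ·)) = #𝒦 := card_image_of_injective _ (add_right_injective K)
    rw [sum_comp_add_left_zeroFrac, ← hcard]
    exact sum_zeroFrac_pow_le hk _ (by rwa [hcard])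
  refine le_of_sq_le_sq ?_ (by positivity)
  refine le_trans ?_ h1
  rw [Fintype.expect_eq_sum_div_card, Fintype.expect_eq_sum_div_card]
  have hc : (0 : ℝ) < Fintype.card (Answer k n) := by exact_mod_cast Fintype.card_pos
  have := sq_sum_le_card_mul_sum_sq (s := (univ : Finset (Answer k n)))
    (f := fun a => |∑ K ∈ 𝒦, sign (parity a K)|)
  simp_rw [sq_abs] at this
  rw [div_pow, div_le_div_iff₀ (by positivity) hc]
  rw [card_univ] at this
  nlinarith

/-- On a fibre of `g` the coefficient is constant, so only the bias of the parity on that fibre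
counts. Fibres with fewer than `2^(k-α)` keys are bounded trivially, and the size of `W` limits
their total. -/
theorem expect_sign_parity_mul_le {k α n m : ℕ} [NeZero k] (hk : α + n ≤ k) {W : Type*}
    [Fintype W] [DecidableEq W] (hW : Fintype.card W * 2 ^ m ≤ 2 ^ α) (g : Bits k → W)
    (c : Answer k n → W → ℝ) (hc : ∀ a ω, |c a ω| ≤ 1 / 2) :
    𝔼 a : Answer k n, 𝔼 K : Bits k, sign (parity a K) * c a (g K)
      ≤ 1 / 2 * hInv (1 - ((α : ℝ) + n) / k) ^ ((n : ℝ) / 2) + 1 / 2 * (1 / 2 ^ m) := by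
  set H := hInv (1 - ((α : ℝ) + n) / k) ^ ((n : ℝ) / 2) with hH
  have hH0 : 0 ≤ H :=
    Real.rpow_nonneg (le_trans (by norm_num) (hInv_spec (entropy_rate_mem hk)).1.1) _
  have h1 : ∀ a : Answer k n, 𝔼 K : Bits k, sign (parity a K) * c a (g K)
      ≤ 1 / 2 ^ k * ∑ ω, 1 / 2 * |∑ K with g K = ω, sign (parity a K)| := by
    intro a
    have hcard : (Fintype.card (Bits k) : ℝ) = 2 ^ k := by simp [ZMod.card]
    rw [Fintype.expect_eq_sum_div_card, hcard, div_eq_mul_one_div, mul_comm]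
    gcongr
    rw [← sum_fiberwise univ g]
    refine sum_le_sum fun ω _ => ?_
    have : ∑ K with g K = ω, sign (parity a K) * c a (g K)
        = c a ω * ∑ K with g K = ω, sign (parity a K) := by
      rw [mul_sum]
      refine sum_congr rfl fun K hK => ?_
      rw [(mem_filter.1 hK).2, mul_comm]
    rw [this]
    refine (le_abs_self _).trans ?_
    rw [abs_mul]
    gcongr
    exact hc a ω
  have h2 : ∀ 𝒦 : Finset (Bits k), 𝔼 a : Answer k n, |∑ K ∈ 𝒦, sign (parity a K)|
      ≤ #𝒦 * H + 2 ^ (k - α) := by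
    intro 𝒦
    rcases le_or_gt ((2 : ℝ) ^ (k - α)) #𝒦 with h | h
    · exact (expect_abs_sum_sign_parity_le hk 𝒦 h).trans (le_add_of_nonneg_right (by positivity))
    · refine (expect_le univ_nonempty (a := (#𝒦 : ℝ)) fun a _ => ?_).trans ?_
      · refine (abs_sum_le_sum_abs _ _).trans ?_
        simp [abs_sign]
      · have : 0 ≤ #𝒦 * H := by positivity
        linarith
  calc _ ≤ 𝔼 a : Answer k n, 1 / 2 ^ k * ∑ ω, 1 / 2 * |∑ K with g K = ω, sign (parity a K)| :=
        expect_le_expect fun a _ => h1 a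
    _ = 1 / 2 ^ k * ∑ ω, 1 / 2 * 𝔼 a : Answer k n, |∑ K with g K = ω, sign (parity a K)| := by
        rw [← mul_expect, expect_sum_comm]
        simp_rw [mul_expect]
    _ ≤ 1 / 2 ^ k * ∑ ω, 1 / 2 * ((#{K | g K = ω} : ℝ) * H + 2 ^ (k - α)) := by
        gcongr with ω
        exact h2 _
    _ = 1 / 2 ^ k * (1 / 2 * (2 ^ k * H + Fintype.card W * 2 ^ (k - α))) := by
        rw [← mul_sum, sum_add_distrib, ← sum_mul, ← Nat.cast_sum,
          ← card_eq_sum_card_fiberwise fun _ _ => mem_univ _]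
        simp [ZMod.card]
    _ = 1 / 2 * H + 1 / 2 * (Fintype.card W * 2 ^ (k - α) / 2 ^ k) := by
        field_simp
    _ ≤ _ := by
        gcongr 1 / 2 * H + 1 / 2 * ?_
        rw [div_le_div_iff₀ (by positivity) (by positivity), one_mul]
        have hW' : (Fintype.card W : ℝ) * 2 ^ m ≤ 2 ^ α := by exact_mod_cast hW
        calc (Fintype.card W : ℝ) * 2 ^ (k - α) * 2 ^ m
            = (Fintype.card W : ℝ) * 2 ^ m * 2 ^ (k - α) := by ring
          _ ≤ 2 ^ α * 2 ^ (k - α) := by gcongr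
          _ = 2 ^ k := by rw [← pow_add]; congr 1; omega

/-- Both sides are half the difference of `v p` and `v (p + 1)`. Subtracting `1/2` costs nothing and
bounds the coefficient by `1/2` when `v` takes values in `[0, 1]`. -/
theorem expect_sub_eq_expect_sign (v : ZMod 2 → ℝ) (p : ZMod 2) :
    𝔼 b, (v p - v b) = 𝔼 b, sign p * (sign b * (v b - 1 / 2)) := by
  rw [Fintype.expect_eq_sum_div_card, Fintype.expect_eq_sum_div_card, sum_zmod_two, sum_zmod_two]
  rcases zmod_two_cases p with rfl | rfl <;> simp [sign]

/-- Replacing a subset parity of the key by a fresh uniform bit is hard to notice for a test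
that sees a short function of the key and of the bit. -/
theorem expect_replace_parity_le {k α n m : ℕ} [NeZero k] (hk : α + n ≤ k) {W : Type*}
    [Fintype W] [DecidableEq W] (hW : Fintype.card W * 2 ^ m ≤ 2 ^ α) (g : Bits k → ZMod 2 → W)
    (u : Answer k n → W → ℝ) (hu : ∀ a ω, u a ω ∈ Set.Icc (0 : ℝ) 1) :
    𝔼 a : Answer k n, 𝔼 K : Bits k, 𝔼 b : ZMod 2, (u a (g K (parity a K)) - u a (g K b))
      ≤ 1 / 2 * hInv (1 - ((α : ℝ) + n) / k) ^ ((n : ℝ) / 2) + 1 / 2 * (1 / 2 ^ m) := by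
  simp_rw [fun a K => expect_sub_eq_expect_sign (fun b => u a (g K b)) (parity a K)]
  -- With the fresh bit `b` fixed outside, `g K b` depends on the key alone.
  simp_rw [expect_comm (univ : Finset (Bits k)) (univ : Finset (ZMod 2))]
  rw [expect_comm]
  refine expect_le univ_nonempty fun b _ => ?_
  refine expect_sign_parity_mul_le hk hW (fun K => g K b) (fun a ω => sign b * (u a ω - 1 / 2))
    fun a ω => ?_
  rw [abs_mul, abs_sign, one_mul, abs_le]
  have := hu a ω
  constructor <;> linarith [this.1, this.2]

/-! ### Indicators -/

/-- The real-valued indicator of a proposition. -/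
def ind (p : Prop) : ℝ := by
  classical exact if p then 1 else 0

theorem ind_true {p : Prop} (hp : p) : ind p = 1 := by simp [ind, hp]

theorem ind_false {p : Prop} (hp : ¬ p) : ind p = 0 := by simp [ind, hp]

theorem ind_nonneg (p : Prop) : 0 ≤ ind p := by
  by_cases hp : p <;> simp [ind, hp]

theorem ind_le_one (p : Prop) : ind p ≤ 1 := by
  by_cases hp : p <;> simp [ind, hp]

theorem ind_le {p : Prop} {c : ℝ} (hc : 0 ≤ c) (h : p → 1 ≤ c) : ind p ≤ c := by
  by_cases hp : p
  · rw [ind_true hp]; exact h hp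
  · rwa [ind_false hp]

theorem ind_mono {p q : Prop} (h : p → q) : ind p ≤ ind q :=
  ind_le (ind_nonneg q) fun hp => (ind_true (h hp)).ge

/-! ### Iterated averages along random maps -/

/-- The mean of `φ` after `n` independent random steps from a given state. -/
def iterMean {Γ S : Type*} [Fintype Γ] (step : Γ → S → S) : ℕ → (S → ℝ) → S → ℝ
  | 0, φ, s => φ s
  | n + 1, φ, s => 𝔼 γ, iterMean step n φ (step γ s)

section iterMean

variable {Γ S : Type*} [Fintype Γ] {step : Γ → S → S}

theorem iterMean_add (a b : ℕ) (φ : S → ℝ) (s : S) :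
    iterMean step (a + b) φ s = iterMean step a (iterMean step b φ) s := by
  induction a generalizing s with
  | zero => rw [zero_add]; rfl
  | succ a ih =>
    rw [Nat.succ_add]
    simp only [iterMean]
    exact expect_congr rfl fun γ _ => ih _

theorem iterMean_succ_last (n : ℕ) (φ : S → ℝ) (s : S) :
    iterMean step (n + 1) φ s = iterMean step n (fun s => 𝔼 γ, φ (step γ s)) s :=
  iterMean_add n 1 φ s

theorem iterMean_le_iterMean {P : S → Prop} (hP : ∀ γ s, P s → P (step γ s)) {φ ψ : S → ℝ}
    (h : ∀ s, P s → φ s ≤ ψ s) (n : ℕ) (s : S) (hs : P s) :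
    iterMean step n φ s ≤ iterMean step n ψ s := by
  induction n generalizing s with
  | zero => exact h s hs
  | succ n ih => exact expect_le_expect fun γ _ => ih _ (hP γ s hs)

theorem iterMean_const [Nonempty Γ] (n : ℕ) (c : ℝ) (s : S) :
    iterMean step n (fun _ => c) s = c := by
  induction n generalizing s with
  | zero => rfl
  | succ n ih => simp [iterMean, ih]

theorem iterMean_const_mul (n : ℕ) (c : ℝ) (φ : S → ℝ) (s : S) :
    iterMean step n (fun s => c * φ s) s = c * iterMean step n φ s := by
  induction n generalizing s with
  | zero => rfl
  | succ n ih => simp only [iterMean, ih, mul_expect]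

theorem iterMean_add_fun (n : ℕ) (φ ψ : S → ℝ) (s : S) :
    iterMean step n (fun s => φ s + ψ s) s = iterMean step n φ s + iterMean step n ψ s := by
  induction n generalizing s with
  | zero => rfl
  | succ n ih => simp only [iterMean, ih, expect_add_distrib]

theorem iterMean_sub_fun (n : ℕ) (φ ψ : S → ℝ) (s : S) :
    iterMean step n (fun s => φ s - ψ s) s = iterMean step n φ s - iterMean step n ψ s := by
  induction n generalizing s with
  | zero => rfl
  | succ n ih => simp only [iterMean, ih, expect_sub_distrib]

theorem iterMean_sum {ι : Type*} (n : ℕ) (t : Finset ι) (φ : ι → S → ℝ) (s : S) :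
    iterMean step n (fun s => ∑ i ∈ t, φ i s) s = ∑ i ∈ t, iterMean step n (φ i) s := by
  induction n generalizing s with
  | zero => rfl
  | succ n ih => simp only [iterMean, ih, expect_sum_comm]

theorem iterMean_expect {ι : Type*} (n : ℕ) (t : Finset ι) (φ : ι → S → ℝ) (s : S) :
    iterMean step n (fun s => 𝔼 i ∈ t, φ i s) s = 𝔼 i ∈ t, iterMean step n (φ i) s := by
  induction n generalizing s with
  | zero => rfl
  | succ n ih =>
    simp only [iterMean, ih]
    rw [expect_comm]

/-- Only the one-step laws of the projected state must match, so the second walk may use its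
randomness differently. This is what identifies the marginals of a coupling. -/
theorem iterMean_comp {Γ' S' : Type*} [Fintype Γ'] {step' : Γ' → S' → S'} (π : S → S')
    (hπ : ∀ (ψ : S' → ℝ) (s : S), 𝔼 γ, ψ (π (step γ s)) = 𝔼 γ, ψ (step' γ (π s)))
    (n : ℕ) (ψ : S' → ℝ) (s : S) :
    iterMean step n (fun s => ψ (π s)) s = iterMean step' n ψ (π s) := by
  induction n generalizing s with
  | zero => rfl
  | succ n ih =>
    simp only [iterMean, ih]
    exact hπ (iterMean step' n ψ) s

theorem iterMean_mul_le_pow {P : S → Prop} (hP : ∀ γ s, P s → P (step γ s)) {φ : S → ℝ} {B : ℕ}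
    {p : ℝ} (hp : 0 ≤ p) (h : ∀ s, P s → iterMean step B φ s ≤ p * φ s) (j : ℕ) (s : S)
    (hs : P s) : iterMean step (j * B) φ s ≤ p ^ j * φ s := by
  induction j generalizing s with
  | zero => simp [iterMean]
  | succ j ih =>
    rw [Nat.succ_mul, add_comm, iterMean_add]
    calc _ ≤ iterMean step B (fun s => p ^ j * φ s) s :=
          iterMean_le_iterMean hP ih B s hs
      _ = p ^ j * iterMean step B φ s := iterMean_const_mul _ _ _ _
      _ ≤ p ^ j * (p * φ s) := by gcongr; exact h s hs
      _ = _ := by ring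

end iterMean

/-! ### Elementary properties of a Thorp round -/

section rounds

variable {m : ℕ}

/-- The last `j` bits agree. -/
def AgreeLast (j : ℕ) (x y : Bits m) : Prop := ∀ i : Fin m, m ≤ i + j → x i = y i

theorem agreeLast_zero (x y : Bits m) : AgreeLast 0 x y := fun i hi => by omega

theorem agreeLast_self_iff {x y : Bits m} : AgreeLast m x y ↔ x = y :=
  ⟨fun h => funext fun i => h i (by omega), fun h i _ => by rw [h]⟩

theorem agreeLast_sub_one_iff {x y : Bits m} : AgreeLast (m - 1) x y ↔ right x = right y := by
  constructor
  · intro h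
    funext i
    exact h _ (by simp only; omega)
  · intro h i hi
    have := congrFun h ⟨(i : ℕ) - 1, by omega⟩
    simp only [right] at this
    have hi' : (⟨(i : ℕ) - 1 + 1, by omega⟩ : Fin m) = i := Fin.ext (by simp only; omega)
    rwa [hi'] at this

theorem thorpRound_apply_of_lt (F : Bits (m - 1) → ZMod 2) (x : Bits m) {i : Fin m}
    (h : (i : ℕ) + 1 < m) : thorpRound F x i = x ⟨i + 1, h⟩ := by
  simp [thorpRound, h]

variable [NeZero m]

theorem eq_of_right_eq {x y : Bits m} (hr : right x = right y) (h0 : x 0 = y 0) : x = y := by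
  funext i
  by_cases hi : i = 0
  · rw [hi, h0]
  · have : (i : ℕ) ≠ 0 := fun h => hi (Fin.ext (by simpa using h))
    exact agreeLast_sub_one_iff.2 hr i (by omega)

theorem thorpRound_apply_of_not_lt (F : Bits (m - 1) → ZMod 2) (x : Bits m) {i : Fin m}
    (h : ¬ (i : ℕ) + 1 < m) : thorpRound F x i = x 0 + F (right x) := by
  simp only [thorpRound, h, dite_false]
  congr

/-- A round is a shift with one new last bit. The condition `i ≠ 0` matters only for `j ≥ m`, since
the first bit is shifted out. -/
theorem agreeLast_succ_thorpRound_iff {j : ℕ} (F F' : Bits (m - 1) → ZMod 2) (x y : Bits m) :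
    AgreeLast (j + 1) (thorpRound F x) (thorpRound F' y) ↔
      (∀ i : Fin m, i ≠ 0 → m ≤ i + j → x i = y i) ∧
        x 0 + F (right x) = y 0 + F' (right y) := by
  have hm : 0 < m := Nat.pos_of_ne_zero (NeZero.ne m)
  constructor
  · intro h
    constructor
    · intro i hi0 hi
      have hi' : (i : ℕ) ≠ 0 := fun h => hi0 (Fin.ext (by simpa using h))
      have := h ⟨i - 1, by omega⟩ (by simp only; omega)
      rw [thorpRound_apply_of_lt _ _ (by simp only; omega),
        thorpRound_apply_of_lt _ _ (by simp only; omega)] at this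
      have hi'' : (⟨(i : ℕ) - 1 + 1, by omega⟩ : Fin m) = i := Fin.ext (by simp only; omega)
      simpa only [hi''] using this
    · have := h ⟨m - 1, by omega⟩ (by simp only; omega)
      rwa [thorpRound_apply_of_not_lt _ _ (by simp only; omega),
        thorpRound_apply_of_not_lt _ _ (by simp only; omega)] at this
  · rintro ⟨h1, h2⟩ i hi
    by_cases hlt : (i : ℕ) + 1 < m
    · rw [thorpRound_apply_of_lt _ _ hlt, thorpRound_apply_of_lt _ _ hlt]
      refine h1 _ (fun h => ?_) (by simp only; omega)
      simpa using congrArg Fin.val h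
    · rw [thorpRound_apply_of_not_lt _ _ hlt, thorpRound_apply_of_not_lt _ _ hlt]
      exact h2

theorem thorpRound_injective (F : Bits (m - 1) → ZMod 2) : Function.Injective (thorpRound F) := by
  intro x y hxy
  have hm : 0 < m := Nat.pos_of_ne_zero (NeZero.ne m)
  have h := (agreeLast_succ_thorpRound_iff (j := m - 1) F F x y).1 (by
    rw [Nat.sub_add_cancel hm, agreeLast_self_iff]; exact hxy)
  have hr : right x = right y := by
    refine agreeLast_sub_one_iff.1 fun i hi => h.1 i (fun h0 => ?_) hi
    rw [h0] at hi
    simp at hi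
    omega
  refine eq_of_right_eq hr ?_
  have := h.2
  rw [hr] at this
  exact add_right_cancel this

/-- A Thorp round as a permutation. -/
def thorpPerm (F : Bits (m - 1) → ZMod 2) : Equiv.Perm (Bits m) :=
  Equiv.ofBijective (thorpRound F) (Finite.injective_iff_bijective.1 (thorpRound_injective F))

@[simp]
theorem thorpPerm_apply (F : Bits (m - 1) → ZMod 2) (x : Bits m) :
    thorpPerm F x = thorpRound F x := rfl

/-- One random Thorp round applied after a permutation. -/
def thorpStep (F : Bits (m - 1) → ZMod 2) (ρ : Equiv.Perm (Bits m)) : Equiv.Perm (Bits m) :=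
  thorpPerm F * ρ

/-- Flipping `F` at `right x` pairs up the round functions, and the new bits agree for at most one
of each pair. For adjacent distinct cards they never agree. -/
theorem expect_newBit_eq_le {x y : Bits m} (hxy : x ≠ y) :
    𝔼 F : Bits (m - 1) → ZMod 2, ind (x 0 + F (right x) = y 0 + F (right y)) ≤ 1 / 2 := by
  set E : (Bits (m - 1) → ZMod 2) → ℝ := fun F => ind (x 0 + F (right x) = y 0 + F (right y))
    with hE
  set e : Bits (m - 1) → ZMod 2 := Pi.single (right x) 1
  have h1 : 𝔼 F, E F = 𝔼 F, E (F + e) :=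
    (Fintype.expect_equiv (Equiv.addRight e) _ _ fun F => rfl).symm
  have h2 : 𝔼 F, (E F + E (F + e)) ≤ 1 := by
    refine expect_le univ_nonempty fun F _ => ?_
    by_cases hF : x 0 + F (right x) = y 0 + F (right y)
    · have hF' : ¬ (x 0 + (F + e) (right x) = y 0 + (F + e) (right y)) := by
        intro hF'
        by_cases hr : right x = right y
        · rw [hr] at hF
          exact hxy (eq_of_right_eq hr (add_right_cancel hF))
        · have h3 : e (right x) = 1 := by simp [e]
          have h4 : e (right y) = 0 := by simp [e, Ne.symm hr]
          rw [Pi.add_apply, Pi.add_apply, h3, h4, add_zero, ← hF, ← add_assoc] at hF'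
          simp at hF'
      simp only [hE]
      rw [ind_false hF', add_zero]
      exact ind_le_one _
    · simp only [hE]
      rw [ind_false hF, zero_add]
      exact ind_le_one _
  rw [expect_add_distrib, ← h1] at h2
  linarith

/-- Two distinct cards are unlikely to agree in their last `j` bits after `j` rounds. -/
theorem iterMean_agreeLast_le {x y : Bits m} (hxy : x ≠ y) (j : ℕ) (hj : j < m)
    (ρ : Equiv.Perm (Bits m)) :
    iterMean thorpStep j (fun ρ => ind (AgreeLast j (ρ x) (ρ y))) ρ ≤ (1 / 2) ^ j := by
  induction j with
  | zero => simpa [iterMean] using ind_le_one _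
  | succ j ih =>
    rw [iterMean_succ_last]
    calc _ ≤ iterMean thorpStep j (fun ρ => 1 / 2 * ind (AgreeLast j (ρ x) (ρ y))) ρ := by
          refine iterMean_le_iterMean (P := fun _ => True) (fun _ _ _ => trivial)
            (fun ρ _ => ?_) j ρ trivial
          by_cases h : AgreeLast j (ρ x) (ρ y)
          · rw [ind_true h, mul_one]
            refine le_trans (expect_le_expect fun F _ => ind_mono fun hF => ?_)
              (expect_newBit_eq_le (ρ.injective.ne hxy))
            exact ((agreeLast_succ_thorpRound_iff F F _ _).1 hF).2
          · rw [ind_false h, mul_zero]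
            refine (expect_eq_zero fun F _ => ind_false fun hF => h fun i hi => ?_).le
            refine ((agreeLast_succ_thorpRound_iff F F _ _).1 hF).1 i (fun h0 => ?_) hi
            rw [h0] at hi
            simp at hi
            omega
      _ ≤ 1 / 2 * (1 / 2) ^ j := by
          rw [iterMean_const_mul]
          gcongr
          exact ih (by omega)
      _ = _ := by ring

/-- After at least `m - 1` rounds two distinct cards are unlikely to be adjacent. -/
theorem iterMean_right_eq_le {x y : Bits m} (hxy : x ≠ y) (r : ℕ) (hr : m - 1 ≤ r)
    (ρ : Equiv.Perm (Bits m)) :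
    iterMean thorpStep r (fun ρ => ind (right (ρ x) = right (ρ y))) ρ ≤ (1 / 2) ^ (m - 1) := by
  have hm : 0 < m := Nat.pos_of_ne_zero (NeZero.ne m)
  -- Only the last `m - 1` rounds matter; the bound is uniform in the state before them.
  rw [← Nat.sub_add_cancel hr, iterMean_add,
    ← iterMean_const (step := thorpStep (m := m)) (r - (m - 1)) ((1 / 2) ^ (m - 1)) ρ]
  refine iterMean_le_iterMean (P := fun _ => True) (fun _ _ _ => trivial) (fun ρ _ => ?_) _ ρ
    trivial
  simpa only [agreeLast_sub_one_iff] using iterMean_agreeLast_le hxy (m - 1) (by omega) ρ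

end rounds

/-! ### Coupling two Thorp shuffles that differ in the start of one card -/

section coupling

variable {m : ℕ}

/-- A pair of permutations, the states of two shuffles. -/
abbrev PermPair (m : ℕ) : Type := Equiv.Perm (Bits m) × Equiv.Perm (Bits m)

/-- In one of the two shuffles the card `x` is adjacent to a card from `D`. -/
def Meets (D : Finset (Bits m)) (x : Bits m) (s : PermPair m) : Prop :=
  ∃ d ∈ D, right (s.1 d) = right (s.1 x) ∨ right (s.2 d) = right (s.2 x)

/-- The cards from `D` have the same positions in both shuffles. -/
def SameOn (D : Finset (Bits m)) (s : PermPair m) : Prop := ∀ d ∈ D, s.1 d = s.2 d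

variable [NeZero m]

open Classical in
/-- The round function of the second shuffle, as a function of that of the first. -/
def coupledFun (D : Finset (Bits m)) (x : Bits m) (s : PermPair m) (F : Bits (m - 1) → ZMod 2) :
    Bits (m - 1) → ZMod 2 :=
  if Meets D x s then F
  else fun R => F (Equiv.swap (right (s.1 x)) (right (s.2 x)) R) +
    if R = right (s.1 x) ∨ R = right (s.2 x) then s.1 x 0 + s.2 x 0 else 0

/-- One round of the coupled pair of shuffles. -/
def coupledStep (D : Finset (Bits m)) (x : Bits m) (F : Bits (m - 1) → ZMod 2) (s : PermPair m) :
    PermPair m :=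
  (thorpStep F s.1, thorpStep (coupledFun D x s F) s.2)

variable {D : Finset (Bits m)} {x : Bits m}

theorem coupledFun_bijective (D : Finset (Bits m)) (x : Bits m) (s : PermPair m) :
    Function.Bijective (coupledFun D x s) := by
  refine Finite.injective_iff_bijective.1 fun F F' h => ?_
  by_cases hs : Meets D x s
  · simpa [coupledFun, hs] using h
  · simp only [coupledFun, hs, if_false] at h
    funext R
    have := congrFun h (Equiv.swap (right (s.1 x)) (right (s.2 x)) R)
    simpa using this

/-- The swap gives the second shuffle the coin used for `x` in the first, and the added constant
corrects for the different leading bits of `x`. -/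
theorem coupledFun_newBit {s : PermPair m} (hs : ¬ Meets D x s) (F : Bits (m - 1) → ZMod 2) :
    s.1 x 0 + F (right (s.1 x)) = s.2 x 0 + coupledFun D x s F (right (s.2 x)) := by
  have key : ∀ a b c : ZMod 2, a + c = b + (c + (a + b)) := by decide
  simp only [coupledFun, hs, if_false, Equiv.swap_apply_right, or_true, if_true]
  exact key _ _ _

/-- The round function is altered only at the two places of `x`, and only when no card of `D`
evaluates it there. -/
theorem coupledFun_apply_of_mem {s : PermPair m} (hs : SameOn D s) (F : Bits (m - 1) → ZMod 2)
    {d : Bits m} (hd : d ∈ D) :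
    coupledFun D x s F (right (s.2 d)) = F (right (s.1 d)) := by
  by_cases hm : Meets D x s
  · simp only [coupledFun, hm, if_true, hs d hd]
  · have h1 : right (s.2 d) ≠ right (s.1 x) := fun h => hm ⟨d, hd, Or.inl (by rw [hs d hd, h])⟩
    have h2 : right (s.2 d) ≠ right (s.2 x) := fun h => hm ⟨d, hd, Or.inr h⟩
    simp only [coupledFun, hm, if_false, Equiv.swap_apply_of_ne_of_ne h1 h2, h1, h2, or_self,
      add_zero, hs d hd]

theorem thorpRound_congr {F F' : Bits (m - 1) → ZMod 2} {y : Bits m}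
    (h : F (right y) = F' (right y)) : thorpRound F y = thorpRound F' y := by
  funext i
  by_cases hi : (i : ℕ) + 1 < m
  · rw [thorpRound_apply_of_lt _ _ hi, thorpRound_apply_of_lt _ _ hi]
  · rw [thorpRound_apply_of_not_lt _ _ hi, thorpRound_apply_of_not_lt _ _ hi, h]

theorem SameOn.coupledStep {s : PermPair m} (hs : SameOn D s) (F : Bits (m - 1) → ZMod 2) :
    SameOn D (coupledStep D x F s) := by
  intro d hd
  have h := coupledFun_apply_of_mem (x := x) hs F hd
  simp only [BigKeyThorp.coupledStep, thorpStep, Equiv.Perm.mul_apply, thorpPerm_apply]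
  rw [hs d hd] at h ⊢
  exact thorpRound_congr h.symm

theorem coupledStep_apply_eq {s : PermPair m} (hx : s.1 x = s.2 x) (F : Bits (m - 1) → ZMod 2) :
    (coupledStep D x F s).1 x = (coupledStep D x F s).2 x := by
  simp only [coupledStep, thorpStep, Equiv.Perm.mul_apply, thorpPerm_apply]
  by_cases hm : Meets D x s
  · simp [coupledFun, hm, hx]
  · have h := coupledFun_newBit hm F
    rw [hx] at h ⊢
    exact thorpRound_congr (add_left_cancel h)

theorem iterMean_coupledStep_fst (ψ : Equiv.Perm (Bits m) → ℝ) (n : ℕ) (s : PermPair m) :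
    iterMean (coupledStep D x) n (fun s => ψ s.1) s = iterMean thorpStep n ψ s.1 :=
  iterMean_comp Prod.fst (fun _ _ => rfl) n ψ s

/-- In each state `coupledFun` is a bijection of round functions, so the second shuffle also uses a
uniform one. -/
theorem iterMean_coupledStep_snd (ψ : Equiv.Perm (Bits m) → ℝ) (n : ℕ) (s : PermPair m) :
    iterMean (coupledStep D x) n (fun s => ψ s.2) s = iterMean thorpStep n ψ s.2 :=
  iterMean_comp Prod.snd (fun _ s => Fintype.expect_bijective (coupledFun D x s)
    (coupledFun_bijective D x s) _ _ fun _ => rfl) n ψ s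

/-- Each round without a meeting appends a common bit, so disagreement requires a meeting in one of
the `j` rounds; a union bound follows. -/
theorem iterMean_not_agreeLast_le (j : ℕ) (s : PermPair m) :
    iterMean (coupledStep D x) j (fun s => ind (¬ AgreeLast j (s.1 x) (s.2 x))) s
      ≤ ∑ r ∈ range j, iterMean (coupledStep D x) r (fun s => ind (Meets D x s)) s := by
  induction j with
  | zero => simp [iterMean, ind, agreeLast_zero]
  | succ j ih =>
    rw [iterMean_succ_last, sum_range_succ]
    refine le_trans ?_ (add_le_add_left ih _)
    rw [← iterMean_add_fun]
    refine iterMean_le_iterMean (P := fun _ => True) (fun _ _ _ => trivial) (fun s _ => ?_) j s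
      trivial
    refine expect_le univ_nonempty fun F _ => ?_
    refine ind_le (add_nonneg (ind_nonneg _) (ind_nonneg _)) fun hne => ?_
    by_cases hm : Meets D x s
    · rw [ind_true hm]
      linarith [ind_nonneg (¬ AgreeLast j (s.1 x) (s.2 x))]
    · have : ¬ AgreeLast j (s.1 x) (s.2 x) := fun hag => hne
        ((agreeLast_succ_thorpRound_iff _ _ _ _).2
          ⟨fun i _ hi => hag i hi, coupledFun_newBit hm F⟩)
      rw [ind_true this]
      linarith [ind_nonneg (Meets D x s)]

theorem iterMean_meets_le (hx : x ∉ D) (r : ℕ) (hr : m - 1 ≤ r) (s : PermPair m) :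
    iterMean (coupledStep D x) r (fun s => ind (Meets D x s)) s
      ≤ #D * (2 * (1 / 2) ^ (m - 1)) := by
  calc _ ≤ iterMean (coupledStep D x) r (fun s => ∑ d ∈ D, (ind (right (s.1 d) = right (s.1 x))
            + ind (right (s.2 d) = right (s.2 x)))) s := by
        refine iterMean_le_iterMean (P := fun _ => True) (fun _ _ _ => trivial) (fun s _ => ?_) r s
          trivial
        have h0 : ∀ d ∈ D, 0 ≤ ind (right (s.1 d) = right (s.1 x))
            + ind (right (s.2 d) = right (s.2 x)) :=
          fun d _ => add_nonneg (ind_nonneg _) (ind_nonneg _)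
        refine ind_le (sum_nonneg h0) ?_
        rintro ⟨d, hd, h⟩
        refine le_trans ?_ (single_le_sum h0 hd)
        rcases h with h | h
        · rw [ind_true h]; linarith [ind_nonneg (right (s.2 d) = right (s.2 x))]
        · rw [ind_true h]; linarith [ind_nonneg (right (s.1 d) = right (s.1 x))]
    _ = ∑ d ∈ D, (iterMean thorpStep r (fun ρ => ind (right (ρ d) = right (ρ x))) s.1
          + iterMean thorpStep r (fun ρ => ind (right (ρ d) = right (ρ x))) s.2) := by
        rw [iterMean_sum]
        refine sum_congr rfl fun d _ => ?_
        rw [iterMean_add_fun,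
          iterMean_coupledStep_fst (fun ρ => ind (right (ρ d) = right (ρ x))),
          iterMean_coupledStep_snd (fun ρ => ind (right (ρ d) = right (ρ x)))]
    _ ≤ _ := by
        rw [← nsmul_eq_mul]
        refine sum_le_card_nsmul _ _ _ fun d hd => ?_
        have hdx : d ≠ x := fun h => hx (h ▸ hd)
        have h1 := iterMean_right_eq_le hdx r hr s.1
        have h2 := iterMean_right_eq_le hdx r hr s.2
        linarith

/-- In `2 m - 1` rounds the two shuffles are likely to bring the card `x` to the same position. -/
theorem iterMean_apply_ne_block_le (hx : x ∉ D) (s : PermPair m) :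
    iterMean (coupledStep D x) (2 * m - 1) (fun s => ind (s.1 x ≠ s.2 x)) s
      ≤ (4 * m * #D / 2 ^ m) * ind (s.1 x ≠ s.2 x) := by
  have hm : 0 < m := Nat.pos_of_ne_zero (NeZero.ne m)
  by_cases hs : s.1 x = s.2 x
  · rw [ind_false (not_not.2 hs), mul_zero]
    calc _ ≤ iterMean (coupledStep D x) (2 * m - 1) (fun _ => 0) s :=
          iterMean_le_iterMean (P := fun s => s.1 x = s.2 x)
            (fun F s hs => coupledStep_apply_eq hs F)
            (fun s hs => (ind_false (not_not.2 hs)).le) _ s hs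
      _ = 0 := iterMean_const _ _ _
  · rw [ind_true hs, mul_one]
    -- The first `m - 1` rounds make meetings unlikely from any start; the other `m` rounds replace
    -- every bit of `x`.
    rw [show 2 * m - 1 = (m - 1) + m by omega, iterMean_add]
    calc _ ≤ iterMean (coupledStep D x) (m - 1) (fun s => ∑ r ∈ range m,
              iterMean (coupledStep D x) r (fun s => ind (Meets D x s)) s) s := by
          refine iterMean_le_iterMean (P := fun _ => True) (fun _ _ _ => trivial) (fun s _ => ?_) _
            s trivial
          simpa only [agreeLast_self_iff] using iterMean_not_agreeLast_le (D := D) (x := x) m s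
      _ = ∑ r ∈ range m,
            iterMean (coupledStep D x) (m - 1 + r) (fun s => ind (Meets D x s)) s := by
          rw [iterMean_sum]
          exact sum_congr rfl fun r _ => (iterMean_add _ _ _ _).symm
      _ ≤ ∑ _r ∈ range m, (#D : ℝ) * (2 * (1 / 2) ^ (m - 1)) :=
          sum_le_sum fun r _ => iterMean_meets_le hx _ (Nat.le_add_right _ _) s
      _ = _ := by
          obtain ⟨j, rfl⟩ : ∃ j, m = j + 1 := ⟨m - 1, by omega⟩
          simp only [sum_const, card_range, nsmul_eq_mul, add_tsub_cancel_right, one_div, inv_pow,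
            pow_succ]
          field_simp
          ring

theorem iterMean_apply_ne_le (hx : x ∉ D) (j : ℕ) (s : PermPair m) :
    iterMean (coupledStep D x) (j * (2 * m - 1)) (fun s => ind (s.1 x ≠ s.2 x)) s
      ≤ (4 * m * #D / 2 ^ m) ^ j := by
  refine (iterMean_mul_le_pow (P := fun _ => True) (fun _ _ _ => trivial) (by positivity)
    (fun s _ => iterMean_apply_ne_block_le hx s) j s trivial).trans ?_
  exact mul_le_of_le_one_right (by positivity) (ind_le_one _)

/-- Moving the start of one card hardly changes the law of its position jointly with those of the
cards in `D`. -/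
theorem iterMean_thorpStep_sub_le (hx : x ∉ D) (j : ℕ) (v : Equiv.Perm (Bits m) → ℝ)
    (hv : ∀ ρ, v ρ ∈ Set.Icc (0 : ℝ) 1)
    (hvD : ∀ ρ ρ' : Equiv.Perm (Bits m), (∀ d ∈ D, ρ d = ρ' d) → ρ x = ρ' x → v ρ = v ρ')
    (s : PermPair m) (hs : SameOn D s) :
    iterMean thorpStep (j * (2 * m - 1)) v s.2 - iterMean thorpStep (j * (2 * m - 1)) v s.1
      ≤ (4 * m * #D / 2 ^ m) ^ j := by
  rw [← iterMean_coupledStep_fst (D := D) (x := x), ← iterMean_coupledStep_snd (D := D) (x := x),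
    ← iterMean_sub_fun]
  refine le_trans ?_ (iterMean_apply_ne_le hx j s)
  refine iterMean_le_iterMean (P := SameOn D) (fun F s hs => hs.coupledStep F)
    (fun s hs => ?_) _ s hs
  by_cases h : s.1 x = s.2 x
  · rw [hvD _ _ hs h, sub_self]
    exact ind_nonneg _
  · rw [ind_true h]
    linarith [(hv s.1).1, (hv s.2).2]

end coupling

/-! ### Thorp shuffles with random round functions are close to random permutations -/

theorem sum_range_pow_le (q s : ℕ) :
    ∑ l ∈ range q, (l : ℝ) ^ s ≤ (q : ℝ) ^ (s + 1) / (s + 1) := by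
  induction q with
  | zero => simp
  | succ q ih =>
    rw [sum_range_succ]
    have hbern : (q : ℝ) ^ (s + 1) + (s + 1) * (q : ℝ) ^ s ≤ ((q : ℝ) + 1) ^ (s + 1) := by
      rw [add_pow]
      rw [sum_range_succ, sum_range_succ]
      simp only [one_pow, mul_one, Nat.choose_self, Nat.cast_one, Nat.choose_succ_self_right]
      have : (0 : ℝ) ≤ ∑ i ∈ range s, (q : ℝ) ^ i * ((s + 1).choose i : ℝ) :=
        sum_nonneg fun i _ => by positivity
      push_cast
      linarith
    rw [le_div_iff₀ (by positivity)] at ih ⊢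
    push_cast
    linarith

theorem sum_range_mul_pow_le (c : ℝ) (hc : 0 ≤ c) (q s : ℕ) :
    ∑ l ∈ range q, (c * l) ^ s ≤ (q : ℝ) / (s + 1) * (c * q) ^ s := by
  simp_rw [mul_pow]
  rw [← mul_sum]
  calc c ^ s * ∑ l ∈ range q, (l : ℝ) ^ s ≤ c ^ s * ((q : ℝ) ^ (s + 1) / (s + 1)) := by
        gcongr
        exact sum_range_pow_le q s
    _ = _ := by ring

section stabilizer

variable {α : Type*} [Fintype α] [DecidableEq α]

/-- The permutations that fix a set pointwise. -/
def fixing (D : Finset α) : Finset (Equiv.Perm α) := {σ | ∀ d ∈ D, σ d = d}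

theorem mem_fixing {D : Finset α} {σ : Equiv.Perm α} : σ ∈ fixing D ↔ ∀ d ∈ D, σ d = d := by
  simp [fixing]

theorem one_mem_fixing (D : Finset α) : (1 : Equiv.Perm α) ∈ fixing D :=
  mem_fixing.2 fun _ _ => rfl

theorem fixing_nonempty (D : Finset α) : (fixing D).Nonempty := ⟨1, one_mem_fixing D⟩

theorem expect_fixing_mul_left {D : Finset α} {τ : Equiv.Perm α} (hτ : τ ∈ fixing D)
    (v : Equiv.Perm α → ℝ) : 𝔼 σ ∈ fixing D, v (τ * σ) = 𝔼 σ ∈ fixing D, v σ := by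
  rw [mem_fixing] at hτ
  refine expect_equiv (Equiv.mulLeft τ) (fun σ => ?_) fun σ _ => rfl
  simp only [mem_fixing, Equiv.coe_mulLeft, Equiv.Perm.mul_apply]
  refine forall₂_congr fun d hd => ?_
  conv_rhs => rhs; rw [← hτ d hd]
  exact τ.injective.eq_iff.symm

/-- Coset decomposition of the stabilizer of `D` according to the image `z` of `x`. -/
theorem expect_fixing_eq {D : Finset α} {x : α} (hx : x ∉ D) (v : Equiv.Perm α → ℝ) :
    𝔼 σ ∈ fixing D, v σ = 𝔼 z ∈ Dᶜ, 𝔼 σ ∈ fixing (insert x D), v (Equiv.swap x z * σ) := by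
  rw [← expect_product']
  refine expect_nbij' (fun σ => (σ x, Equiv.swap x (σ x) * σ))
    (fun p => Equiv.swap x p.1 * p.2) ?_ ?_ ?_ ?_ ?_
  · intro σ hσ
    rw [mem_fixing] at hσ
    simp only [mem_product, mem_compl, mem_fixing, mem_insert, Equiv.Perm.mul_apply]
    refine ⟨fun h => hx ?_, ?_⟩
    · have := σ.injective (hσ _ h)
      rwa [this] at h
    · rintro d (rfl | hd)
      · simp
      · rw [hσ d hd, Equiv.swap_apply_of_ne_of_ne]
        · rintro rfl; exact hx hd
        · intro h
          have := σ.injective ((hσ d hd).trans h)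
          exact hx (this ▸ hd)
  · rintro ⟨z, σ⟩ hp
    simp only [mem_product, mem_compl, mem_fixing, mem_insert] at hp
    rw [mem_fixing]
    intro d hd
    rw [Equiv.Perm.mul_apply, hp.2 d (Or.inr hd), Equiv.swap_apply_of_ne_of_ne]
    · rintro rfl; exact hx hd
    · rintro rfl; exact hp.1 hd
  · intro σ _
    rw [← mul_assoc, Equiv.swap_mul_self, one_mul]
  · rintro ⟨z, σ⟩ hp
    simp only [mem_product, mem_compl, mem_fixing, mem_insert] at hp
    have h1 : (Equiv.swap x z * σ) x = z := by
      rw [Equiv.Perm.mul_apply, hp.2 x (Or.inl rfl), Equiv.swap_apply_left]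
    simp only [h1]
    rw [← mul_assoc, Equiv.swap_mul_self, one_mul]
  · intro σ _
    rw [← mul_assoc, Equiv.swap_mul_self, one_mul]

end stabilizer

section mixing

variable {m : ℕ} [NeZero m]

theorem iterMean_thorpStep_mul_right (n : ℕ) (v : Equiv.Perm (Bits m) → ℝ)
    (ρ σ : Equiv.Perm (Bits m)) :
    iterMean thorpStep n v (ρ * σ) = iterMean thorpStep n (fun ρ => v (ρ * σ)) ρ :=
  (iterMean_comp (· * σ) (fun _ _ => rfl) n v ρ).symm

/-- Each round is a left translation, which preserves the uniform law. -/
theorem expect_iterMean_thorpStep (n : ℕ) (v : Equiv.Perm (Bits m) → ℝ) :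
    𝔼 σ, iterMean thorpStep n v σ = 𝔼 σ, v σ := by
  induction n with
  | zero => rfl
  | succ n ih =>
    simp only [iterMean]
    rw [expect_comm]
    have : ∀ F : Bits (m - 1) → ZMod 2, 𝔼 σ, iterMean thorpStep n v (thorpStep F σ)
        = 𝔼 σ, v σ := by
      intro F
      rw [← ih]
      exact Fintype.expect_equiv (Equiv.mulLeft (thorpPerm F)) _ _ fun σ => rfl
    simp [this]

/-- The random Thorp shuffle of `j * (2 * m - 1)` rounds, applied after a random permutation that
fixes `D`, hardly changes when the permutation has to fix one more point. -/
theorem expect_fixing_insert_sub_le {D : Finset (Bits m)} {x : Bits m} (hx : x ∉ D) (j : ℕ)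
    (v : Equiv.Perm (Bits m) → ℝ) (hv : ∀ ρ, v ρ ∈ Set.Icc (0 : ℝ) 1) :
    𝔼 σ ∈ fixing (insert x D), iterMean thorpStep (j * (2 * m - 1)) v σ
        - 𝔼 σ ∈ fixing D, iterMean thorpStep (j * (2 * m - 1)) v σ
      ≤ (4 * m * #D / 2 ^ m) ^ j := by
  -- Averaging over the stabilizer makes the test depend only on the cards in `D` and `x`, as the
  -- coupling requires.
  set w : Equiv.Perm (Bits m) → ℝ := fun ρ => 𝔼 σ ∈ fixing (insert x D), v (ρ * σ) with hw
  have hw01 : ∀ ρ, w ρ ∈ Set.Icc (0 : ℝ) 1 := fun ρ =>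
    ⟨expect_nonneg fun σ _ => (hv _).1, expect_le (fixing_nonempty _) fun σ _ => (hv _).2⟩
  have hwD : ∀ ρ ρ' : Equiv.Perm (Bits m), (∀ d ∈ D, ρ d = ρ' d) → ρ x = ρ' x → w ρ = w ρ' := by
    intro ρ ρ' hD hx'
    have hτ : ρ'⁻¹ * ρ ∈ fixing (insert x D) := by
      rw [mem_fixing]
      intro d hd
      rw [Equiv.Perm.mul_apply, Equiv.Perm.inv_eq_iff_eq]
      rcases mem_insert.1 hd with rfl | hd
      · exact hx'
      · exact hD d hd
    have := expect_fixing_mul_left hτ fun σ => v (ρ' * σ)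
    simpa only [hw, ← mul_assoc, mul_inv_cancel, one_mul] using this
  have hmean : ∀ τ : Equiv.Perm (Bits m), 𝔼 σ ∈ fixing (insert x D),
      iterMean thorpStep (j * (2 * m - 1)) v (τ * σ)
        = iterMean thorpStep (j * (2 * m - 1)) w τ := by
    intro τ
    rw [hw, iterMean_expect]
    exact expect_congr rfl fun σ _ => iterMean_thorpStep_mul_right _ _ _ _
  have hne : (Dᶜ).Nonempty := ⟨x, mem_compl.2 hx⟩
  rw [expect_fixing_eq hx]
  simp_rw [hmean]
  have h1 := hmean 1
  simp_rw [one_mul] at h1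
  rw [h1, ← expect_const hne (iterMean thorpStep (j * (2 * m - 1)) w 1), ← expect_sub_distrib]
  refine expect_le hne fun z hz => ?_
  refine iterMean_thorpStep_sub_le hx j w hw01 hwD (Equiv.swap x z, 1) fun d hd => ?_
  have hdz : d ≠ z := by rintro rfl; exact (mem_compl.1 hz) hd
  have hdx : d ≠ x := by rintro rfl; exact hx hd
  simp [Equiv.swap_apply_of_ne_of_ne hdx hdz]

/-- The random Thorp shuffle of `q` cards is close to a random permutation. -/
theorem iterMean_thorpStep_sub_expect_le {q : ℕ} (M : Fin q ↪ Bits m) (s : ℕ)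
    (v : Equiv.Perm (Bits m) → ℝ) (hv : ∀ ρ, v ρ ∈ Set.Icc (0 : ℝ) 1)
    (hvM : ∀ ρ ρ' : Equiv.Perm (Bits m), (∀ i, ρ (M i) = ρ' (M i)) → v ρ = v ρ') :
    iterMean thorpStep (s * (2 * m - 1)) v 1 - 𝔼 π, v π
      ≤ (q : ℝ) / (s + 1) * (4 * m * q / 2 ^ m) ^ s := by
  set D : ℕ → Finset (Bits m) := fun l => ({i : Fin q | (i : ℕ) < l} : Finset (Fin q)).map M
    with hD
  set E : ℕ → ℝ := fun l => 𝔼 σ ∈ fixing (D l), iterMean thorpStep (s * (2 * m - 1)) v σ with hE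
  have h0 : E 0 = 𝔼 π, v π := by
    have : fixing (D 0) = univ := by ext σ; simp [hD, mem_fixing]
    simp only [hE, this, expect_iterMean_thorpStep]
  have hq : E q = iterMean thorpStep (s * (2 * m - 1)) v 1 := by
    have hconst : ∀ σ ∈ fixing (D q), iterMean thorpStep (s * (2 * m - 1)) v σ
        = iterMean thorpStep (s * (2 * m - 1)) v 1 := by
      intro σ hσ
      rw [← one_mul σ, iterMean_thorpStep_mul_right]
      congr 1
      funext ρ
      refine hvM _ _ fun i => ?_
      rw [Equiv.Perm.mul_apply, mem_fixing.1 hσ (M i) (by simp [hD])]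
    simp only [hE]
    rw [expect_congr rfl hconst, expect_const (fixing_nonempty _)]
  have hstep : ∀ l ∈ range q, E (l + 1) - E l ≤ (4 * m / 2 ^ m * l) ^ s := by
    intro l hl
    rw [mem_range] at hl
    have hins : D (l + 1) = insert (M ⟨l, hl⟩) (D l) := by
      simp only [hD]
      rw [← map_insert]
      congr 1
      ext i
      simp only [mem_filter, mem_univ, true_and, mem_insert, Fin.ext_iff]
      omega
    have hnot : M ⟨l, hl⟩ ∉ D l := by simp [hD]
    have hcard : #(D l) = l := by
      simp only [hD, card_map]
      rw [Fin.card_filter_val_lt, min_eq_right hl.le]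
    have := expect_fixing_insert_sub_le hnot s v hv
    simp only [hE]
    rw [hins]
    rw [hcard] at this
    convert this using 2
    ring
  rw [← h0, ← hq, ← sum_range_sub]
  refine (sum_le_sum hstep).trans ((sum_range_mul_pow_le _ (by positivity) q s).trans_eq ?_)
  congr 2
  ring

end mixing

/-! ### Trajectories of messages -/

section trajectories

variable {m T : ℕ}

/-- The composition of `T` Thorp rounds with the given round functions. -/
def thorpCipher (f : Query m T → ZMod 2) (x : Bits m) : Bits m :=
  Fin.foldl T (fun y r => thorpRound (fun R => f (R, r)) y) x

theorem cipher_eq_thorpCipher {k n : ℕ} (O : Oracle k m n T) (K : Bits k) (x : Bits m) :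
    cipher O K x = thorpCipher (fun a => parity (O a) K) x := rfl

/-- The position of a message after the first `r` rounds. -/
def traj (f : Query m T → ZMod 2) : ℕ → Bits m → Bits m
  | 0, x => x
  | r + 1, x =>
    if h : r < T then thorpRound (fun R => f (R, ⟨r, h⟩)) (traj f r x) else traj f r x

theorem foldl_eq_of_succ {β : Type*} (T : ℕ) (g : Fin T → β → β) (y : ℕ → β)
    (h : ∀ r : Fin T, y (r + 1) = g r (y r)) :
    Fin.foldl T (fun z r => g r z) (y 0) = y T := by
  induction T with
  | zero => simp
  | succ T ih =>
    rw [Fin.foldl_succ_last, ih (fun r => g r.castSucc) fun r => h r.castSucc]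
    exact (h (Fin.last T)).symm

theorem thorpCipher_eq_traj (f : Query m T → ZMod 2) (x : Bits m) :
    thorpCipher f x = traj f T x :=
  foldl_eq_of_succ T (fun r => thorpRound fun R => f (R, r)) (fun r => traj f r x)
    fun r => by simp [traj]

/-- The point at which round `r` evaluates the round function for the message `x`. -/
def visit (f : Query m T → ZMod 2) (x : Bits m) (r : Fin T) : Query m T :=
  (right (traj f r x), r)

/-- A trajectory reads the table only at the points it visits; agreement is assumed along the
trajectory of `f` alone. -/
theorem traj_congr [NeZero m] {f g : Query m T → ZMod 2} {x : Bits m} (r : ℕ)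
    (h : ∀ r' : Fin T, (r' : ℕ) < r → f (visit f x r') = g (visit f x r')) :
    traj f r x = traj g r x := by
  induction r with
  | zero => rfl
  | succ r ih =>
    have ih' := ih fun r' hr' => h r' (by omega)
    by_cases hr : r < T
    · simp only [traj, hr, dite_true]
      rw [← ih']
      exact thorpRound_congr (h ⟨r, hr⟩ (by simp))
    · simp only [traj, hr, dite_false, ih']

theorem traj_bijective [NeZero m] (f : Query m T → ZMod 2) (r : ℕ) :
    Function.Bijective (traj f r) := by
  refine Finite.injective_iff_bijective.1 ?_
  induction r with
  | zero => exact fun x y h => h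
  | succ r ih =>
    by_cases hr : r < T
    · simp only [traj, hr, dite_true]
      exact (thorpRound_injective _).comp ih
    · simpa only [traj, hr, dite_false] using ih

/-- Splitting off the first round of a family of round functions. -/
def roundFunConsEquiv (m T : ℕ) :
    (Query m (T + 1) → ZMod 2) ≃ (Bits (m - 1) → ZMod 2) × (Query m T → ZMod 2) where
  toFun f := (fun R => f (R, 0), fun a => f (a.1, a.2.succ))
  invFun p a := Fin.cases (p.1 a.1) (fun r => p.2 (a.1, r)) a.2
  left_inv f := by
    funext ⟨R, r⟩
    refine Fin.cases ?_ (fun r => ?_) r <;> simp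
  right_inv p := by
    ext <;> simp

theorem expect_thorpCipher_eq_iterMean [NeZero m] (φ : (Bits m → Bits m) → ℝ)
    (ρ : Equiv.Perm (Bits m)) :
    𝔼 f : Query m T → ZMod 2, φ (fun x => thorpCipher f (ρ x))
      = iterMean thorpStep T (fun ρ => φ ρ) ρ := by
  induction T generalizing ρ with
  | zero =>
    simp [thorpCipher, iterMean]
  | succ T ih =>
    simp only [iterMean]
    simp_rw [← ih]
    rw [← expect_product']
    refine Fintype.expect_equiv (roundFunConsEquiv m T) _ _ fun f => ?_
    congr 1
    funext x
    simp only [thorpCipher, Fin.foldl_succ]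
    rfl

end trajectories

/-! ### Averages over messages and over tables -/

/-- Translation acts on tuples of distinct messages, so each single message is uniform. -/
theorem expect_embedding_apply {β : Type*} [Fintype β] [AddGroup β] [DecidableEq β] {q : ℕ}
    [Nonempty (Fin q ↪ β)] (i : Fin q) (φ : β → ℝ) :
    𝔼 M : Fin q ↪ β, φ (M i) = 𝔼 x, φ x := by
  have h1 : ∀ c : β, 𝔼 M : Fin q ↪ β, φ (M i + c) = 𝔼 M : Fin q ↪ β, φ (M i) := fun c =>
    Fintype.expect_equiv (Equiv.embeddingCongr (Equiv.refl _) (Equiv.addRight c)) _ _ fun M => rfl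
  have h2 : ∀ y : β, 𝔼 c, φ (y + c) = 𝔼 x, φ x := fun y =>
    Fintype.expect_equiv (Equiv.addLeft y) _ _ fun c => rfl
  calc _ = 𝔼 c : β, 𝔼 M : Fin q ↪ β, φ (M i + c) := by simp [h1]
    _ = _ := by rw [expect_comm]; simp [h2]

/-- Resampling one value preserves the uniform law: exchanging the old value with the fresh one is
an involution. -/
theorem expect_update {I A : Type*} [Fintype I] [DecidableEq I] [Fintype A] [Nonempty A] (x : I)
    (ψ : (I → A) → ℝ) : 𝔼 O, 𝔼 a, ψ (Function.update O x a) = 𝔼 O, ψ O := by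
  have h : 𝔼 p : (I → A) × A, ψ (Function.update p.1 x p.2) = 𝔼 p : (I → A) × A, ψ p.1 := by
    have hinv : Function.Involutive fun p : (I → A) × A => (Function.update p.1 x p.2, p.1 x) := by
      intro p; simp
    exact Fintype.expect_equiv hinv.toPerm _ _ fun p => rfl
  rw [← univ_product_univ, expect_product, expect_product] at h
  simpa using h

theorem expect_ind_right_eq_le {m : ℕ} [NeZero m] (R : Bits (m - 1)) :
    𝔼 y : Bits m, ind (right y = R) ≤ 1 / 2 ^ (m - 1) := by
  classical
  have hm : 0 < m := Nat.pos_of_ne_zero (NeZero.ne m)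
  have h1 : ∑ y : Bits m, ind (right y = R) = (#{y : Bits m | right y = R} : ℝ) := by
    rw [card_filter]
    push_cast
    exact sum_congr rfl fun y _ => by simp [ind]
  have h2 : #{y : Bits m | right y = R} ≤ 2 := by
    have : #{y : Bits m | right y = R} ≤ #(univ : Finset (ZMod 2)) := by
      refine card_le_card_of_injOn (fun y => y 0) (fun _ _ => mem_coe.2 (mem_univ _)) ?_
      intro y hy y' hy' h
      simp only [coe_filter, mem_univ, true_and, Set.mem_ofPred_eq] at hy hy'
      exact eq_of_right_eq (hy.trans hy'.symm) h
    simpa [ZMod.card] using this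
  have h3 : (Fintype.card (Bits m) : ℝ) = 2 * 2 ^ (m - 1) := by
    rw [← pow_succ', Nat.sub_add_cancel hm]
    simp [ZMod.card]
  rw [Fintype.expect_eq_sum_div_card, h1, h3, div_le_div_iff₀ (by positivity) (by positivity)]
  have : (#{y : Bits m | right y = R} : ℝ) ≤ 2 := by exact_mod_cast h2
  nlinarith [show (0 : ℝ) < 2 ^ (m - 1) by positivity]

/-- The expected number of visited points in a given set. -/
theorem sum_expect_visit_mem_le {m q T : ℕ} [NeZero m] [Nonempty (Fin q ↪ Bits m)]
    (S : Finset (Query m T)) (f : Query m T → ZMod 2) :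
    ∑ i : Fin q, ∑ r : Fin T, 𝔼 M : Fin q ↪ Bits m, ind (visit f (M i) r ∈ S)
      ≤ q * #S / 2 ^ (m - 1) := by
  classical
  have h1 : ∀ (i : Fin q) (r : Fin T), 𝔼 M : Fin q ↪ Bits m, ind (visit f (M i) r ∈ S)
      ≤ #{a ∈ S | a.2 = r} * (1 / 2 ^ (m - 1)) := by
    intro i r
    -- The position before round `r` is a bijective image of a uniform message. Only points of `S`
    -- with round number `r` can be hit, so summing over `r` costs no factor `T`.
    rw [expect_embedding_apply i fun x => ind (visit f x r ∈ S),
      Fintype.expect_bijective (traj f r) (traj_bijective f r)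
        (fun x => ind (visit f x r ∈ S)) (fun y => ind ((right y, r) ∈ S)) fun _ => rfl]
    calc _ ≤ 𝔼 y : Bits m, ∑ a ∈ S with a.2 = r, ind (right y = a.1) := by
          refine expect_le_expect fun y _ => ?_
          refine ind_le (sum_nonneg fun a _ => ind_nonneg _) fun h => ?_
          have hmem : (right y, r) ∈ ({a ∈ S | a.2 = r} : Finset (Query m T)) :=
            mem_filter.2 ⟨h, rfl⟩
          rw [← ind_true (rfl : right y = right y)]
          exact single_le_sum (f := fun a : Query m T => ind (right y = a.1))
            (fun a _ => ind_nonneg _) hmem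
      _ ≤ _ := by
          rw [expect_sum_comm, ← nsmul_eq_mul]
          exact sum_le_card_nsmul _ _ _ fun a _ => expect_ind_right_eq_le a.1
  calc _ ≤ ∑ _i : Fin q, ∑ r : Fin T, (#{a ∈ S | a.2 = r} : ℝ) * (1 / 2 ^ (m - 1)) :=
        sum_le_sum fun i _ => sum_le_sum fun r _ => h1 i r
    _ = _ := by
        rw [← sum_mul, ← Nat.cast_sum, ← card_eq_sum_card_fiberwise fun _ _ => mem_univ _]
        simp
        ring

/-! ### The points queried by an algorithm -/

/-- The set of points at which an algorithm queries the oracle. -/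
def OracleAlg.queried {I A β : Type} [DecidableEq I] (O : I → A) :
    {Q : ℕ} → OracleAlg I A β Q → Finset I
  | _, .ret _ => ∅
  | _, .ask x next => insert x ((next (O x)).queried O)

theorem OracleAlg.card_queried_le {I A β : Type} [DecidableEq I] (O : I → A) {Q : ℕ}
    (𝒜 : OracleAlg I A β Q) : #(𝒜.queried O) ≤ Q := by
  induction 𝒜 with
  | ret b => simp [queried]
  | ask x next ih => exact (card_insert_le _ _).trans (Nat.succ_le_succ (ih _))

theorem OracleAlg.run_congr {I A β : Type} [DecidableEq I] {O O' : I → A} {Q : ℕ}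
    (𝒜 : OracleAlg I A β Q) (h : ∀ x ∈ 𝒜.queried O, O x = O' x) : 𝒜.run O = 𝒜.run O' := by
  induction 𝒜 with
  | ret b => rfl
  | ask x next ih =>
    have hx := h x (mem_insert_self _ _)
    simp only [run]
    rw [← hx]
    exact ih _ fun y hy => h y (mem_insert_of_mem hy)

theorem OracleAlg.run_update {I A β : Type} [DecidableEq I] {O : I → A} {Q : ℕ}
    (𝒜 : OracleAlg I A β Q) {x : I} (hx : x ∉ 𝒜.queried O) (a : A) :
    𝒜.run (Function.update O x a) = 𝒜.run O :=
  (𝒜.run_congr fun y hy => by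
    rw [Function.update_of_ne]
    rintro rfl
    exact hx hy).symm

/-! ### Replacing a table point by point along an adaptive exploration -/

section exploration

variable {I : Type*}

open Classical in
/-- The table that agrees with `f` on `V` and with `g` elsewhere. -/
def mix {A : Type*} (V : Set I) (f g : I → A) : I → A := fun a => if a ∈ V then f a else g a

theorem mix_empty {A : Type*} (f g : I → A) : mix ∅ f g = g := by
  funext a; simp [mix]

theorem mix_congr {A : Type*} {V : Set I} {f f' g g' : I → A} (hf : ∀ a ∈ V, f a = f' a)
    (hg : ∀ a, a ∉ V → g a = g' a) : mix V f g = mix V f' g' := by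
  funext a
  by_cases ha : a ∈ V
  · simp [mix, ha, hf a ha]
  · simp [mix, ha, hg a ha]

theorem mix_insert_update {A : Type*} [DecidableEq I] (V : Set I) (f g : I → A) (x : I) (b : A) :
    mix (insert x V) (Function.update f x b) g = Function.update (mix V f g) x b := by
  funext a
  by_cases hax : a = x
  · subst hax; simp [mix]
  · by_cases ha : a ∈ V <;> simp [mix, hax, ha]

theorem mix_update {A : Type*} [DecidableEq I] {V : Set I} (f g : I → A) {x : I} (hx : x ∉ V)
    (b : A) : mix V f (Function.update g x b) = Function.update (mix V f g) x b := by
  funext a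
  by_cases hax : a = x
  · subst hax; simp [mix, hx]
  · simp [mix, hax]

/-- Each point of the exploration is determined by the values at the earlier points. -/
def Adapted {A : Type*} {N : ℕ} (pt : Fin N → (I → A) → I) : Prop :=
  ∀ (t : Fin N) (f g : I → A), (∀ u < t, f (pt u f) = g (pt u f)) → pt t f = pt t g

/-- The first `t` points of the exploration. -/
def visited {A : Type*} {N : ℕ} (pt : Fin N → (I → A) → I) (t : ℕ) (f : I → A) : Set I :=
  {a | ∃ u : Fin N, (u : ℕ) < t ∧ pt u f = a}

theorem visited_zero {A : Type*} {N : ℕ} (pt : Fin N → (I → A) → I) (f : I → A) :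
    visited pt 0 f = ∅ := by
  ext a; simp [visited]

theorem visited_succ {A : Type*} {N : ℕ} (pt : Fin N → (I → A) → I) (t : Fin N) (f : I → A) :
    visited pt (t + 1) f = insert (pt t f) (visited pt t f) := by
  ext a
  simp only [visited, Set.mem_ofPred_eq, Set.mem_insert_iff]
  constructor
  · rintro ⟨u, hu, rfl⟩
    rcases Nat.lt_succ_iff_lt_or_eq.1 hu with h | h
    · exact Or.inr ⟨u, h, rfl⟩
    · left; rw [Fin.ext h]
  · rintro (rfl | ⟨u, hu, rfl⟩)
    · exact ⟨t, by omega, rfl⟩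
    · exact ⟨u, by omega, rfl⟩

/-- The points up to time `t` are determined by values at earlier points, none of which is the point
being changed. -/
theorem Adapted.congr_off {A : Type*} {N : ℕ} {pt : Fin N → (I → A) → I} (hpt : Adapted pt)
    {t : Fin N} {f g : I → A} (hx : pt t f ∉ visited pt t f) (hfg : ∀ a, a ≠ pt t f → f a = g a) :
    pt t g = pt t f ∧ visited pt t g = visited pt t f := by
  have h : ∀ u ≤ t, pt u f = pt u g := fun u hu =>
    hpt u f g fun u' hu' => hfg _ fun h => hx ⟨u', lt_of_lt_of_le hu' hu, h⟩
  refine ⟨(h t le_rfl).symm, ?_⟩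
  ext a
  refine exists_congr fun u => and_congr_right fun hu => ?_
  rw [h u (le_of_lt (by exact_mod_cast hu))]

theorem add_apply_update_add_one [DecidableEq I] (G : (I → ZMod 2) → ℝ) (f : I → ZMod 2)
    (x : I) :
    G f + G (Function.update f x (f x + 1))
      = G (Function.update f x 0) + G (Function.update f x 1) := by
  have h := Function.update_eq_self x f
  rcases zmod_two_cases (f x) with h0 | h0
  · rw [h0] at h ⊢
    rw [h, zero_add]
  · rw [h0] at h ⊢
    rw [h, show (1 : ZMod 2) + 1 = 0 by decide, add_comm]

variable [Fintype I] [DecidableEq I]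

/-- If exposing any single new point costs at most `c` on average over the value there, then the
next point of an adaptive exploration costs at most the mean of `c` at that point. -/
theorem expect_visited_sub_le {N : ℕ} {pt : Fin N → (I → ZMod 2) → I} (hpt : Adapted pt)
    (t : Fin N) (Θ : Set I → (I → ZMod 2) → ℝ)
    (hΘ : ∀ V f g, (∀ a ∈ V, f a = g a) → Θ V f = Θ V g) (c : I → ℝ) (hc : ∀ x, 0 ≤ c x)
    (h : ∀ V f x, x ∉ V → 𝔼 b, (Θ V f - Θ (insert x V) (Function.update f x b)) ≤ c x) :
    𝔼 f, (Θ (visited pt t f) f - Θ (visited pt (t + 1) f) f) ≤ 𝔼 f, c (pt t f) := by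
  classical
  -- Flipping the value at a newly reached point changes neither the past nor that point, so `flip`
  -- is an involution, and averaging over its orbits averages over a fresh bit there. At an old
  -- point nothing new is exposed.
  set flip : (I → ZMod 2) → (I → ZMod 2) := fun f =>
    if pt t f ∈ visited pt t f then f else Function.update f (pt t f) (f (pt t f) + 1) with hflip
  set δ : (I → ZMod 2) → ℝ := fun f => Θ (visited pt t f) f - Θ (visited pt (t + 1) f) f with hδ
  have htwo : ∀ b : ZMod 2, b + 1 + 1 = b := by decide
  have hoff : ∀ f, pt t f ∉ visited pt t f →
      pt t (flip f) = pt t f ∧ visited pt t (flip f) = visited pt t f := by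
    intro f hf
    refine hpt.congr_off hf fun a ha => ?_
    simp [hflip, hf, Function.update_of_ne ha]
  have hupd : ∀ f, pt t f ∉ visited pt t f →
      flip f = Function.update f (pt t f) (f (pt t f) + 1) := by
    intro f hf
    simp [hflip, hf]
  have hinv : Function.Involutive flip := by
    intro f
    by_cases hf : pt t f ∈ visited pt t f
    · simp [hflip, hf]
    · have h1 := hoff f hf
      rw [hupd (flip f) (by rwa [h1.1, h1.2]), h1.1, hupd f hf]
      simp [htwo]
  have hsym : 𝔼 f, δ (flip f) = 𝔼 f, δ f :=
    Fintype.expect_equiv hinv.toPerm _ _ fun f => rfl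
  have hpt2 : ∀ f, δ f + δ (flip f) ≤ 2 * c (pt t f) := by
    intro f
    by_cases hf : pt t f ∈ visited pt t f
    · have h1 : flip f = f := by simp [hflip, hf]
      have h2 : δ f = 0 := by
        simp only [hδ]
        rw [visited_succ, Set.insert_eq_of_mem hf, sub_self]
      rw [h1, h2]
      linarith [hc (pt t f)]
    · have h1 := hoff f hf
      have h2 := hupd f hf
      have h3 : Θ (visited pt t f) (flip f) = Θ (visited pt t f) f := by
        refine hΘ _ _ _ fun a ha => ?_
        rw [h2, Function.update_of_ne]
        rintro rfl
        exact hf ha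
      have h4 := h (visited pt t f) f (pt t f) hf
      simp only [hδ]
      rw [visited_succ, visited_succ, h1.1, h1.2, h3]
      rw [Fintype.expect_eq_sum_div_card, sum_zmod_two, ZMod.card] at h4
      have h5 : Θ (insert (pt t f) (visited pt t f)) f
          + Θ (insert (pt t f) (visited pt t f)) (flip f)
          = Θ (insert (pt t f) (visited pt t f)) (Function.update f (pt t f) 0)
          + Θ (insert (pt t f) (visited pt t f)) (Function.update f (pt t f) 1) := by
        rw [h2]
        exact add_apply_update_add_one (Θ (insert (pt t f) (visited pt t f))) f (pt t f)
      push_cast at h4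
      linarith
  have h6 : 𝔼 f, (δ f + δ (flip f)) ≤ 𝔼 f, 2 * c (pt t f) := expect_le_expect fun f _ => hpt2 f
  rw [expect_add_distrib, hsym, ← mul_expect] at h6
  linarith

end exploration

/-! ### From the cipher to the Thorp shuffle with random round functions -/

section hybrid

variable {k m n ℓ q Q T : ℕ}

/-- The points at which the round functions are evaluated on the messages, message by message. -/
def explore (M : Fin q → Bits m) (t : Fin (q * T)) (f : Query m T → ZMod 2) : Query m T :=
  visit f (M (finProdFinEquiv.symm t).1) (finProdFinEquiv.symm t).2

theorem adapted_explore [NeZero m] (M : Fin q → Bits m) :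
    Adapted (explore (T := T) M) := by
  intro t f g h
  obtain ⟨⟨i, r⟩, rfl⟩ := finProdFinEquiv.surjective t
  simp only [explore, Equiv.symm_apply_apply, visit]
  rw [traj_congr (r : ℕ) fun r' hr' => ?_]
  have := h (finProdFinEquiv (i, r')) (by
    rw [Fin.lt_def]
    simp only [finProdFinEquiv_apply_val]
    omega)
  simpa only [explore, Equiv.symm_apply_apply] using this

/-- The end of the hybrid argument: every value that encryption reads already comes from `f`. -/
theorem thorpCipher_mix_visited [NeZero m] (M : Fin q → Bits m) (f g : Query m T → ZMod 2)
    (i : Fin q) :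
    thorpCipher (mix (visited (explore M) (q * T) f) f g) (M i) = thorpCipher f (M i) := by
  rw [thorpCipher_eq_traj, thorpCipher_eq_traj]
  refine (traj_congr T fun r _ => ?_).symm
  have : visit f (M i) r ∈ visited (explore M) (q * T) f :=
    ⟨finProdFinEquiv (i, r), Fin.is_lt _, by simp [explore]⟩
  simp [mix, this]

/-- The indicator that a deterministic adversary guesses world 1. -/
def accept (A : DetAdversary k m n ℓ q Q T) (O : Oracle k m n T) (K : Bits k)
    (M : Fin q → Bits m) (C : Fin q → Bits m) : ℝ :=
  ind ((A.run O).2 { leakage := (A.run O).1 K, pairs := fun i => (M i, C i), oracle := O } = true)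

theorem accept_mem (A : DetAdversary k m n ℓ q Q T) (O : Oracle k m n T) (K : Bits k)
    (M : Fin q → Bits m) (C : Fin q → Bits m) : accept A O K M C ∈ Set.Icc (0 : ℝ) 1 :=
  ⟨ind_nonneg _, ind_le_one _⟩

/-- The probability of guessing world 1 when the round functions take the values `f` on `V` and
come from the big-key pseudorandom function elsewhere. -/
def hybridAccept (A : DetAdversary k m n ℓ q Q T) (M : Fin q → Bits m) (V : Set (Query m T))
    (f : Query m T → ZMod 2) : ℝ :=
  𝔼 O : Oracle k m n T, 𝔼 K : Bits k,
    accept A O K M fun i => thorpCipher (mix V f fun a => parity (O a) K) (M i)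

theorem hybridAccept_congr (A : DetAdversary k m n ℓ q Q T) (M : Fin q → Bits m)
    (V : Set (Query m T)) (f g : Query m T → ZMod 2) (h : ∀ a ∈ V, f a = g a) :
    hybridAccept A M V f = hybridAccept A M V g := by
  simp only [hybridAccept]
  refine expect_congr rfl fun O _ => expect_congr rfl fun K _ => ?_
  rw [mix_congr h fun _ _ => rfl]

variable [NeZero k]

/-- The cost of replacing one value of the pseudorandom function by a fresh bit. -/
theorem hybridAccept_insert_le {α : ℕ} (hα : ℓ + m * (q + 1) ≤ α) (hk : α + n ≤ k)
    (A : DetAdversary k m n ℓ q Q T) (M : Fin q → Bits m) (V : Set (Query m T))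
    (f : Query m T → ZMod 2) (x : Query m T) (hx : x ∉ V) :
    𝔼 b, (hybridAccept A M V f - hybridAccept A M (insert x V) (Function.update f x b))
      ≤ (1 / 2 * hInv (1 - ((α : ℝ) + n) / k) ^ ((n : ℝ) / 2) + 1 / 2 * (1 / 2 ^ m))
        + 𝔼 O : Oracle k m n T, ind (x ∈ A.queried O) := by
  set ε := 1 / 2 * hInv (1 - ((α : ℝ) + n) / k) ^ ((n : ℝ) / 2) + 1 / 2 * (1 / 2 ^ m) with hε
  have hε0 : 0 ≤ ε := by
    have := Real.rpow_nonneg (le_trans (by norm_num) (hInv_spec (entropy_rate_mem hk)).1.1)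
      ((n : ℝ) / 2)
    positivity
  have h1 : 𝔼 b, (hybridAccept A M V f - hybridAccept A M (insert x V) (Function.update f x b))
      = 𝔼 O : Oracle k m n T, 𝔼 K : Bits k, 𝔼 b : ZMod 2,
        ((accept A O K M fun i => thorpCipher (mix V f fun a => parity (O a) K) (M i))
        - accept A O K M fun i =>
            thorpCipher (Function.update (mix V f fun a => parity (O a) K) x b) (M i)) := by
    simp only [hybridAccept, mix_insert_update, ← expect_sub_distrib]
    rw [expect_comm]
    exact expect_congr rfl fun O _ => expect_comm _ _ _
  -- Resample the oracle at `x`. Unless `x` was queried, the leakage function and the guessing rule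
  -- do not depend on the fresh answer.
  rw [h1, ← expect_update x]
  have h2 : ε + 𝔼 O : Oracle k m n T, ind (x ∈ A.queried O)
      = 𝔼 O : Oracle k m n T, (ε + ind (x ∈ A.queried O)) := by
    rw [expect_add_distrib, Fintype.expect_const]
  rw [h2]
  refine expect_le_expect fun O _ => ?_
  by_cases hxO : x ∈ A.queried O
  · rw [ind_true hxO]
    refine le_trans ?_ (le_add_of_nonneg_left hε0)
    refine expect_le univ_nonempty fun a _ => expect_le univ_nonempty fun K _ =>
      expect_le univ_nonempty fun b _ => ?_
    exact (sub_le_self _ (accept_mem _ _ _ _ _).1).trans (accept_mem _ _ _ _ _).2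
  · rw [ind_false hxO, add_zero]
    -- Leakage and ciphertexts take `ℓ + mq` bits; the extra `m` in the budget pays for the error
    -- `2^(-m)` of small key classes.
    have hcard : Fintype.card (Bits ℓ × (Fin q → Bits m)) * 2 ^ m ≤ 2 ^ α := by
      simp only [Fintype.card_prod, Fintype.card_pi, ZMod.card, prod_const, card_univ,
        Fintype.card_fin]
      rw [← pow_mul, ← pow_add, ← pow_add]
      refine Nat.pow_le_pow_right (by norm_num) (le_trans (le_of_eq ?_) hα)
      ring
    have key := expect_replace_parity_le hk hcard
      (fun K b => ((A.run O).1 K, fun i =>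
        thorpCipher (Function.update (mix V f fun a => parity (O a) K) x b) (M i)))
      (fun a ω => ind ((A.run O).2
        { leakage := ω.1
          pairs := fun i => (M i, ω.2 i)
          oracle := Function.update O x a } = true))
      fun a ω => ⟨ind_nonneg _, ind_le_one _⟩
    refine le_of_eq_of_le ?_ key
    refine expect_congr rfl fun a _ => expect_congr rfl fun K _ => expect_congr rfl fun b _ => ?_
    have h3 : (fun y => parity (Function.update O x a y) K)
        = Function.update (fun y => parity (O y) K) x (parity a K) := by
      funext y
      by_cases hy : y = x
      · subst hy; simp
      · simp [hy]
    rw [h3, mix_update f _ hx, Function.update_idem]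
    simp only [accept, A.run_update hxO]

end hybrid

section advantage

variable {k m n ℓ q Q T : ℕ} [NeZero k] [NeZero m]

/-- Replacing the pseudorandom function by a random one along the trajectories of all messages. -/
theorem expect_cipher_sub_expect_thorpCipher_le {α : ℕ} (hα : ℓ + m * (q + 1) ≤ α)
    (hk : α + n ≤ k) (A : DetAdversary k m n ℓ q Q T) [Nonempty (Fin q ↪ Bits m)] :
    𝔼 M : Fin q ↪ Bits m, 𝔼 O : Oracle k m n T, 𝔼 K : Bits k,
        accept A O K M (fun i => cipher O K (M i))
      - 𝔼 M : Fin q ↪ Bits m, 𝔼 O : Oracle k m n T, 𝔼 K : Bits k,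
        𝔼 f : Query m T → ZMod 2, accept A O K M (fun i => thorpCipher f (M i))
      ≤ q * T * (1 / 2 * hInv (1 - ((α : ℝ) + n) / k) ^ ((n : ℝ) / 2) + 1 / 2 * (1 / 2 ^ m))
        + q * Q / 2 ^ (m - 1) := by
  set ε := 1 / 2 * hInv (1 - ((α : ℝ) + n) / k) ^ ((n : ℝ) / 2) + 1 / 2 * (1 / 2 ^ m) with hε
  have hε0 : 0 ≤ ε := by
    have := Real.rpow_nonneg (le_trans (by norm_num) (hInv_spec (entropy_rate_mem hk)).1.1)
      ((n : ℝ) / 2)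
    positivity
  have hM : ∀ M : Fin q ↪ Bits m, 𝔼 O : Oracle k m n T, 𝔼 K : Bits k,
        accept A O K M (fun i => cipher O K (M i))
      - 𝔼 O : Oracle k m n T, 𝔼 K : Bits k,
        𝔼 f : Query m T → ZMod 2, accept A O K M (fun i => thorpCipher f (M i))
      ≤ q * T * ε + 𝔼 f : Query m T → ZMod 2, 𝔼 O : Oracle k m n T,
        ∑ i : Fin q, ∑ r : Fin T, ind (visit f (M i) r ∈ A.queried O) := by
    intro M
    set G : ℕ → ℝ := fun t => 𝔼 f, hybridAccept A M (visited (explore M) t f) f with hG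
    have h0 : G 0 = 𝔼 O : Oracle k m n T, 𝔼 K : Bits k,
        accept A O K M (fun i => cipher O K (M i)) := by
      have : ∀ f : Query m T → ZMod 2, hybridAccept A M (visited (explore M) 0 f) f
          = 𝔼 O : Oracle k m n T, 𝔼 K : Bits k,
            accept A O K M (fun i => cipher O K (M i)) := by
        intro f
        simp [hybridAccept, visited_zero, mix_empty, cipher_eq_thorpCipher]
      simp only [hG, this, Fintype.expect_const]
    have hN : G (q * T) = 𝔼 O : Oracle k m n T, 𝔼 K : Bits k,
        𝔼 f : Query m T → ZMod 2, accept A O K M (fun i => thorpCipher f (M i)) := by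
      simp only [hG, hybridAccept, thorpCipher_mix_visited]
      rw [expect_comm]
      exact expect_congr rfl fun O _ => expect_comm _ _ _
    have hstep : ∀ t : Fin (q * T), G t - G (t + 1)
        ≤ ε + 𝔼 f : Query m T → ZMod 2, 𝔼 O : Oracle k m n T,
          ind (explore M t f ∈ A.queried O) := by
      intro t
      have h1 := expect_visited_sub_le (adapted_explore M) t (hybridAccept A M)
        (hybridAccept_congr A M)
        (fun x => ε + 𝔼 O : Oracle k m n T, ind (x ∈ A.queried O))
        (fun x => add_nonneg hε0 (expect_nonneg fun O _ => ind_nonneg _))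
        (fun V f x hx => hybridAccept_insert_le hα hk A M V f x hx)
      rwa [expect_sub_distrib, expect_add_distrib, Fintype.expect_const] at h1
    calc _ = G 0 - G (q * T) := by rw [h0, hN]
      _ = ∑ t : Fin (q * T), (G t - G (t + 1)) := by
          rw [← sum_range_sub' G, Fin.sum_univ_eq_sum_range fun t => G t - G (t + 1)]
      _ ≤ ∑ t : Fin (q * T), (ε + 𝔼 f : Query m T → ZMod 2, 𝔼 O : Oracle k m n T,
          ind (explore M t f ∈ A.queried O)) := sum_le_sum fun t _ => hstep t
      _ = _ := by
          rw [sum_add_distrib, sum_const, card_univ, Fintype.card_fin, nsmul_eq_mul,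
            ← expect_sum_comm]
          push_cast
          congr 1
          refine expect_congr rfl fun f _ => ?_
          rw [← expect_sum_comm]
          refine expect_congr rfl fun O _ => ?_
          rw [← Fintype.sum_prod_type']
          refine (Fintype.sum_equiv finProdFinEquiv _ _ fun p => ?_).symm
          simp [explore]
  rw [← expect_sub_distrib]
  calc _ ≤ 𝔼 M : Fin q ↪ Bits m, (q * T * ε + 𝔼 f : Query m T → ZMod 2, 𝔼 O : Oracle k m n T,
        ∑ i : Fin q, ∑ r : Fin T, ind (visit f (M i) r ∈ A.queried O)) :=
        expect_le_expect fun M _ => hM M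
    _ = q * T * ε + 𝔼 f : Query m T → ZMod 2, 𝔼 O : Oracle k m n T,
        ∑ i : Fin q, ∑ r : Fin T, 𝔼 M : Fin q ↪ Bits m, ind (visit f (M i) r ∈ A.queried O) := by
        rw [expect_add_distrib, Fintype.expect_const, expect_comm]
        congr 1
        refine expect_congr rfl fun f _ => ?_
        rw [expect_comm]
        refine expect_congr rfl fun O _ => ?_
        simp only [expect_sum_comm]
    _ ≤ _ := by
        gcongr
        -- The table `f` and the queried set are fixed before the messages are averaged.
        refine expect_le univ_nonempty fun f _ => expect_le univ_nonempty fun O _ => ?_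
        refine (sum_expect_visit_mem_le (A.queried O) f).trans ?_
        gcongr
        exact A.card_queried_le O

theorem expect_thorpCipher_sub_expect_perm_le {s : ℕ} (hT : T = s * (2 * m - 1))
    (M : Fin q ↪ Bits m) (u : (Fin q → Bits m) → ℝ) (hu : ∀ C, u C ∈ Set.Icc (0 : ℝ) 1) :
    𝔼 f : Query m T → ZMod 2, u (fun i => thorpCipher f (M i))
      - 𝔼 π : Equiv.Perm (Bits m), u (fun i => π (M i))
      ≤ (q : ℝ) / (s + 1) * (4 * m * q / 2 ^ m) ^ s := by
  have h1 := expect_thorpCipher_eq_iterMean (T := T) (fun X => u fun i => X (M i)) 1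
  simp only [Equiv.Perm.coe_one, id] at h1
  rw [h1, hT]
  refine iterMean_thorpStep_sub_expect_le M s (fun ρ => u fun i => ρ (M i)) (fun ρ => hu _) ?_
  intro ρ ρ' h
  simp only [h]

/-- The advantage of a deterministic adversary. -/
theorem expect_accept_sub_le {s α : ℕ} (hT : T = s * (2 * m - 1)) (hα : ℓ + m * (q + 1) ≤ α)
    (hk : α + n ≤ k) (A : DetAdversary k m n ℓ q Q T) [Nonempty (Fin q ↪ Bits m)] :
    𝔼 O : Oracle k m n T, 𝔼 K : Bits k, 𝔼 M : Fin q ↪ Bits m,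
        accept A O K M (fun i => cipher O K (M i))
      - 𝔼 O : Oracle k m n T, 𝔼 K : Bits k, 𝔼 M : Fin q ↪ Bits m,
        𝔼 π : Equiv.Perm (Bits m), accept A O K M (fun i => π (M i))
      ≤ (q : ℝ) / (s + 1) * (4 * m * q / 2 ^ m) ^ s
        + q * T / 2 * hInv (1 - ((α : ℝ) + n) / k) ^ ((n : ℝ) / 2)
        + q * Q / 2 ^ (m - 1)
        + q * T / 2 ^ m := by
  have hcomm : ∀ φ : Oracle k m n T → Bits k → (Fin q ↪ Bits m) → ℝ,
      𝔼 O, 𝔼 K, 𝔼 M, φ O K M = 𝔼 M, 𝔼 O, 𝔼 K, φ O K M := by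
    intro φ
    rw [expect_comm univ univ fun M O => 𝔼 K, φ O K M]
    exact expect_congr rfl fun O _ => expect_comm _ _ _
  rw [hcomm, hcomm]
  have h1 := expect_cipher_sub_expect_thorpCipher_le hα hk A
  have h2 : 𝔼 M : Fin q ↪ Bits m, 𝔼 O : Oracle k m n T, 𝔼 K : Bits k,
        𝔼 f : Query m T → ZMod 2, accept A O K M (fun i => thorpCipher f (M i))
      - 𝔼 M : Fin q ↪ Bits m, 𝔼 O : Oracle k m n T, 𝔼 K : Bits k,
        𝔼 π : Equiv.Perm (Bits m), accept A O K M (fun i => π (M i))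
      ≤ (q : ℝ) / (s + 1) * (4 * m * q / 2 ^ m) ^ s := by
    simp only [← expect_sub_distrib]
    refine expect_le univ_nonempty fun M _ => expect_le univ_nonempty fun O _ =>
      expect_le univ_nonempty fun K _ => ?_
    exact expect_thorpCipher_sub_expect_perm_le hT M (accept A O K M) (accept_mem A O K M)
  have h3 : (q : ℝ) * T * (1 / 2 * (1 / 2 ^ m)) ≤ q * T / 2 ^ m := by
    have : (0 : ℝ) ≤ q * T / 2 ^ m := by positivity
    calc (q : ℝ) * T * (1 / 2 * (1 / 2 ^ m)) = q * T / 2 ^ m / 2 := by ring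
      _ ≤ _ := by linarith
  have h4 : (q : ℝ) * T * (1 / 2 * hInv (1 - ((α : ℝ) + n) / k) ^ ((n : ℝ) / 2))
      = q * T / 2 * hInv (1 - ((α : ℝ) + n) / k) ^ ((n : ℝ) / 2) := by ring
  rw [mul_add, h4] at h1
  linarith

end advantage

/-! ### From probability mass functions to averages -/

theorem toReal_uniformOfFintype_bind {β γ : Type*} [Fintype β] [Nonempty β] (p : β → PMF γ)
    (c : γ) : ((PMF.uniformOfFintype β).bind p c).toReal = 𝔼 b, (p b c).toReal := by
  rw [PMF.bind_apply, tsum_fintype,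
    ENNReal.toReal_sum fun b _ => ENNReal.mul_ne_top (PMF.apply_ne_top _ _) (PMF.apply_ne_top _ _),
    Fintype.expect_eq_sum_div_card, div_eq_inv_mul, mul_sum]
  refine sum_congr rfl fun b _ => ?_
  simp [PMF.uniformOfFintype_apply]

theorem toReal_pure_bool (b : Bool) : (PMF.pure b true).toReal = ind (b = true) := by
  cases b <;> simp [ind, PMF.pure_apply]

/-- A mixture of adversaries does no better than the bound common to all of them. Moving the
subtracted term across keeps the possibly infinite sums in `ENNReal`, where summability is
automatic. -/
theorem toReal_bind_sub_le {β γ : Type*} (p : PMF β) (f g : β → PMF γ) (c : γ) {B : ℝ}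
    (hB : 0 ≤ B) (h : ∀ b, (f b c).toReal - (g b c).toReal ≤ B) :
    (p.bind f c).toReal - (p.bind g c).toReal ≤ B := by
  have h1 : ∀ b, f b c ≤ g b c + ENNReal.ofReal B := by
    intro b
    rw [← ENNReal.ofReal_toReal (PMF.apply_ne_top (f b) c),
      ← ENNReal.ofReal_toReal (PMF.apply_ne_top (g b) c),
      ← ENNReal.ofReal_add ENNReal.toReal_nonneg hB]
    exact ENNReal.ofReal_le_ofReal (by linarith [h b])
  have h2 : p.bind f c ≤ p.bind g c + ENNReal.ofReal B := by
    rw [PMF.bind_apply, PMF.bind_apply]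
    calc ∑' b, p b * f b c ≤ ∑' b, (p b * g b c + p b * ENNReal.ofReal B) := by
          refine ENNReal.tsum_le_tsum fun b => ?_
          rw [← mul_add]
          gcongr
          exact h1 b
      _ = _ := by rw [ENNReal.tsum_add, ENNReal.tsum_mul_right, p.tsum_coe, one_mul]
  have h3 := ENNReal.toReal_mono
    (ENNReal.add_ne_top.2 ⟨PMF.apply_ne_top _ _, ENNReal.ofReal_ne_top⟩) h2
  rw [ENNReal.toReal_add (PMF.apply_ne_top _ _) ENNReal.ofReal_ne_top, ENNReal.toReal_ofReal hB]
    at h3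
  linarith

end BigKeyThorp

end

theorem theorem1 (k m n ℓ q Q s T α : ℕ) [NeZero k] (hm : 1 ≤ m) (hq : q ≤ 2 ^ m)
    (hT : T = s * (2 * m - 1)) (hα : α = ℓ + m * (q + 1) + T) (hk : α + n ≤ k) :
    BigKeyThorp.maxAdv k m n ℓ q Q T hq ≤
      (q : ℝ) / (s + 1) * (4 * m * q / 2 ^ m) ^ s
        + q * T / 2 * BigKeyThorp.hInv (1 - ((α : ℝ) + n) / k) ^ ((n : ℝ) / 2)
        + q * Q / 2 ^ (m - 1)
        + q * T / 2 ^ m := by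
  have : NeZero m := ⟨by omega⟩
  have := BigKeyThorp.nonempty_messages hq
  have hH := Real.rpow_nonneg (le_trans (by norm_num)
    (BigKeyThorp.hInv_spec (BigKeyThorp.entropy_rate_mem hk)).1.1) ((n : ℝ) / 2)
  refine Real.iSup_le (fun 𝒜 => ?_) (by positivity)
  unfold BigKeyThorp.adv BigKeyThorp.world1 BigKeyThorp.world0
  refine BigKeyThorp.toReal_bind_sub_le _ _ _ _ (by positivity) fun A => ?_
  simp only [BigKeyThorp.randomMessages, BigKeyThorp.toReal_uniformOfFintype_bind,
    BigKeyThorp.toReal_pure_bool]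
  exact BigKeyThorp.expect_accept_sub_le hT (by omega) hk A
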